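/- Let $\mathcal{C}$ be a model category and let $s\mathcal{C}$ be the category of simplicial objects $\Delta^{op}\to\mathcal{C}$. For $X$ in $s\mathcal{C}$ let $L_nX$ be the colimit of $X_j$ over the category of maps $[j]\to[n]$ in $\Delta^{op}$ with $j<n$, and let $M_nX$ be the limit of $X_j$ over the category of maps $[n]\to[j]$ in $\Delta^{op}$ with $j<n$ (morphisms in both being the commuting triangles). A map $f\colon X\to Y$ in $s\mathcal{C}$ is a level equivalence if each $X_n\to Y_n$ is a weak equivalence in $\mathcal{C}$, a Reedy cofibration if each $X_n\amalg_{L_nX}L_nY\to Y_n$ is a cofibration in $\mathcal{C}$, and a Reedy fibration if each $X_n\to Y_n\times_{M_nY}M_nX$ is a fibration in $\mathcal{C}$. An object $X$ of $s\mathcal{C}$ is Reedy fibrant if the map from $X$ to the terminal object is a Reedy fibration, and homotopically constant if all its face and degeneracy operators $d_i$, $s_i$ are weak equivalences in $\mathcal{C}$. A model structure on $s\mathcal{C}$ is called canonical if every level equivalence is a weak equivalence, its cofibrations are the Reedy cofibrations, and its fibrant objects are exactly the homotopically constant, Reedy fibrant objects. Suppose that $s\mathcal{C}$ is equipped with a canonical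 model structure. Then: 1. The adjoint pair $(c,\mathrm{Ev})$, where $c\colon\mathcal{C}\to s\mathcal{C}$ is the constant object functor and $\mathrm{Ev}\,X=X_0$ is its right adjoint, is a Quillen equivalence between $\mathcal{C}$ and $s\mathcal{C}$ with the canonical model structure: $c$ preserves cofibrations and trivial cofibrations, and the total derived functors of $c$ and $\mathrm{Ev}$ exist and form, with the derived adjunction, an equivalence between the homotopy categories. 2. A map in $s\mathcal{C}$ between fibrant objects of the canonical model structure is a weak equivalence of the canonical model structure if and only if it is a level equivalence. 3. A map in $s\mathcal{C}$ between fibrant objects of the canonical model structure is a fibration of the canonical model structure if and only if it is a Reedy fibration. -/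

import Mathlib

open CategoryTheory Limits HomotopicalAlgebra Opposite
open scoped Simplicial

universe v v' u u'

namespace CanonicalModel

noncomputable section

/-! ### Latching and matching objects of a simplicial object -/

/-- The category `𝓛ₙ`: objects are the maps `[j] ⟶ [n]` in `Δᵒᵖ` with `j < n`, morphisms are the
commuting triangles. -/
abbrev LatchingCategory (n : ℕ) : Type :=
  ObjectProperty.FullSubcategory
    (fun f : Over (op ⦋n⦌ : SimplexCategoryᵒᵖ) => f.left.unop.len < n)

/-- The category `𝓜ₙ`: objects are the maps `[n] ⟶ [j]` in `Δᵒᵖ` with `j < n`, morphisms are the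
commuting triangles. -/
abbrev MatchingCategory (n : ℕ) : Type :=
  ObjectProperty.FullSubcategory
    (fun f : Under (op ⦋n⦌ : SimplexCategoryᵒᵖ) => f.right.unop.len < n)

/-- The forgetful functor `𝓛ₙ ⥤ Δᵒᵖ`. -/
abbrev latchingForget (n : ℕ) : LatchingCategory n ⥤ SimplexCategoryᵒᵖ :=
  ObjectProperty.ι _ ⋙ Over.forget _

/-- The forgetful functor `𝓜ₙ ⥤ Δᵒᵖ`. -/
abbrev matchingForget (n : ℕ) : MatchingCategory n ⥤ SimplexCategoryᵒᵖ :=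
  ObjectProperty.ι _ ⋙ Under.forget _

instance finite_hom_op (a b : SimplexCategoryᵒᵖ) : Finite (a ⟶ b) :=
  Finite.of_injective (fun f => f.unop) (fun _ _ h => Quiver.Hom.unop_inj h)

instance finite_latchingCategory (n : ℕ) : Finite (LatchingCategory n) :=
  Finite.of_injective
    (β := Σ j : Fin n, ((op ⦋j.1⦌ : SimplexCategoryᵒᵖ) ⟶ op ⦋n⦌))
    (fun f => ⟨⟨f.obj.left.unop.len, f.property⟩, f.obj.hom⟩) (by
      rintro ⟨⟨⟨⟨a⟩⟩, ⟨⟨⟩⟩, f⟩, hf⟩ ⟨⟨⟨⟨b⟩⟩, ⟨⟨⟩⟩, g⟩, hg⟩ h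
      simp only [Sigma.mk.injEq, Fin.mk.injEq] at h
      obtain ⟨h1, h2⟩ := h
      change a = b at h1
      subst h1
      obtain rfl := eq_of_heq h2
      rfl)

instance finite_matchingCategory (n : ℕ) : Finite (MatchingCategory n) :=
  Finite.of_injective
    (β := Σ j : Fin n, ((op ⦋n⦌ : SimplexCategoryᵒᵖ) ⟶ op ⦋j.1⦌))
    (fun f => ⟨⟨f.obj.right.unop.len, f.property⟩, f.obj.hom⟩) (by
      rintro ⟨⟨⟨⟨⟩⟩, ⟨⟨a⟩⟩, f⟩, hf⟩ ⟨⟨⟨⟨⟩⟩, ⟨⟨b⟩⟩, g⟩, hg⟩ h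
      simp only [Sigma.mk.injEq, Fin.mk.injEq] at h
      obtain ⟨h1, h2⟩ := h
      change a = b at h1
      subst h1
      obtain rfl := eq_of_heq h2
      rfl)

instance finite_hom_latchingCategory (n : ℕ) (a b : LatchingCategory n) : Finite (a ⟶ b) :=
  Finite.of_injective (fun f => f.hom.left) (fun _ _ h => by
    apply InducedCategory.hom_ext
    exact Over.OverMorphism.ext h)

instance finite_hom_matchingCategory (n : ℕ) (a b : MatchingCategory n) : Finite (a ⟶ b) :=
  Finite.of_injective (fun f => f.hom.right) (fun _ _ h => by
    apply InducedCategory.hom_ext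
    exact Under.UnderMorphism.ext h)

instance finCategory_latchingCategory (n : ℕ) : FinCategory (LatchingCategory n) where
  fintypeObj := Fintype.ofFinite _
  fintypeHom _ _ := Fintype.ofFinite _

instance finCategory_matchingCategory (n : ℕ) : FinCategory (MatchingCategory n) where
  fintypeObj := Fintype.ofFinite _
  fintypeHom _ _ := Fintype.ofFinite _

variable {C : Type u} [Category.{v} C]

section Latching

variable [HasFiniteColimits C]

/-- The latching object `Lₙ X`. -/
def latchingObj (n : ℕ) (X : SimplicialObject C) : C :=
  colimit (latchingForget n ⋙ X)

/-- The map `Lₙ X ⟶ Lₙ Y` induced by `f : X ⟶ Y`. -/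
def latchingObjMap (n : ℕ) {X Y : SimplicialObject C} (f : X ⟶ Y) :
    latchingObj n X ⟶ latchingObj n Y :=
  colimMap (Functor.whiskerLeft (latchingForget n) f)

/-- The cocone with point `Xₙ` on the diagram that defines `Lₙ X`. -/
@[simps]
def latchingCocone (n : ℕ) (X : SimplicialObject C) : Cocone (latchingForget n ⋙ X) where
  pt := X.obj (op ⦋n⦌)
  ι :=
    { app := fun j => X.map j.obj.hom
      naturality := fun i j f => by
        simp [← X.map_comp] }

/-- The canonical map `Lₙ X ⟶ Xₙ`. -/
def latchingMap (n : ℕ) (X : SimplicialObject C) : latchingObj n X ⟶ X.obj (op ⦋n⦌) :=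
  colimit.desc _ (latchingCocone n X)

lemma ι_latchingMap (n : ℕ) (X : SimplicialObject C) (j : LatchingCategory n) :
    (colimit.ι (latchingForget n ⋙ X) j : X.obj j.obj.left ⟶ latchingObj n X) ≫ latchingMap n X =
      X.map j.obj.hom :=
  colimit.ι_desc _ _

lemma ι_latchingObjMap (n : ℕ) {X Y : SimplicialObject C} (f : X ⟶ Y) (j : LatchingCategory n) :
    (colimit.ι (latchingForget n ⋙ X) j : X.obj j.obj.left ⟶ latchingObj n X) ≫
      latchingObjMap n f = f.app j.obj.left ≫ colimit.ι (latchingForget n ⋙ Y) j :=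
  ι_colimMap _ _

lemma latchingMap_naturality (n : ℕ) {X Y : SimplicialObject C} (f : X ⟶ Y) :
    latchingMap n X ≫ f.app (op ⦋n⦌) = latchingObjMap n f ≫ latchingMap n Y := by
  apply colimit.hom_ext
  intro j
  exact (Category.assoc _ _ _).symm.trans <| (congrArg (· ≫ _) (ι_latchingMap n X j)).trans <|
    (f.naturality j.obj.hom).trans <| (congrArg (_ ≫ ·) (ι_latchingMap n Y j)).symm.trans <|
    (Category.assoc _ _ _).symm.trans <| (congrArg (· ≫ _) (ι_latchingObjMap n f j)).symm.trans <|
    Category.assoc _ _ _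

/-- The relative latching map `Xₙ ∐_{Lₙ X} Lₙ Y ⟶ Yₙ` of `f : X ⟶ Y`. -/
def relativeLatchingMap (n : ℕ) {X Y : SimplicialObject C} (f : X ⟶ Y) :
    pushout (latchingMap n X) (latchingObjMap n f) ⟶ Y.obj (op ⦋n⦌) :=
  pushout.desc (f.app (op ⦋n⦌)) (latchingMap n Y) (latchingMap_naturality n f)

end Latching

section Matching

variable [HasFiniteLimits C]

/-- The matching object `Mₙ X`. -/
def matchingObj (n : ℕ) (X : SimplicialObject C) : C :=
  limit (matchingForget n ⋙ X)

/-- The map `Mₙ X ⟶ Mₙ Y` induced by `f : X ⟶ Y`. -/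
def matchingObjMap (n : ℕ) {X Y : SimplicialObject C} (f : X ⟶ Y) :
    matchingObj n X ⟶ matchingObj n Y :=
  limMap (Functor.whiskerLeft (matchingForget n) f)

/-- The cone with point `Xₙ` on the diagram that defines `Mₙ X`. -/
@[simps]
def matchingCone (n : ℕ) (X : SimplicialObject C) : Cone (matchingForget n ⋙ X) where
  pt := X.obj (op ⦋n⦌)
  π :=
    { app := fun j => X.map j.obj.hom
      naturality := fun i j f => by
        simp [← X.map_comp] }

/-- The canonical map `Xₙ ⟶ Mₙ X`. -/
def matchingMap (n : ℕ) (X : SimplicialObject C) : X.obj (op ⦋n⦌) ⟶ matchingObj n X :=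
  limit.lift _ (matchingCone n X)

lemma matchingMap_π (n : ℕ) (X : SimplicialObject C) (j : MatchingCategory n) :
    matchingMap n X ≫ (limit.π (matchingForget n ⋙ X) j : matchingObj n X ⟶ X.obj j.obj.right) =
      X.map j.obj.hom :=
  limit.lift_π _ _

lemma matchingObjMap_π (n : ℕ) {X Y : SimplicialObject C} (f : X ⟶ Y) (j : MatchingCategory n) :
    matchingObjMap n f ≫
        (limit.π (matchingForget n ⋙ Y) j : matchingObj n Y ⟶ Y.obj j.obj.right) =
      limit.π (matchingForget n ⋙ X) j ≫ f.app j.obj.right :=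
  limMap_π _ _

lemma matchingMap_naturality (n : ℕ) {X Y : SimplicialObject C} (f : X ⟶ Y) :
    f.app (op ⦋n⦌) ≫ matchingMap n Y = matchingMap n X ≫ matchingObjMap n f := by
  apply limit.hom_ext
  intro j
  exact (Category.assoc _ _ _).trans <| (congrArg (_ ≫ ·) (matchingMap_π n Y j)).trans <|
    (f.naturality j.obj.hom).symm.trans <| (congrArg (· ≫ _) (matchingMap_π n X j)).symm.trans <|
    (Category.assoc _ _ _).trans <| (congrArg (_ ≫ ·) (matchingObjMap_π n f j)).symm.trans <|
    (Category.assoc _ _ _).symm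

/-- The relative matching map `Xₙ ⟶ Yₙ ×_{Mₙ Y} Mₙ X` of `f : X ⟶ Y`. -/
def relativeMatchingMap (n : ℕ) {X Y : SimplicialObject C} (f : X ⟶ Y) :
    X.obj (op ⦋n⦌) ⟶ pullback (matchingMap n Y) (matchingObjMap n f) :=
  pullback.lift (f.app (op ⦋n⦌)) (matchingMap n X) (matchingMap_naturality n f)

end Matching

/-! ### Classes of maps and objects in `sC`, for a model category `C` -/

section Reedy

variable (C) [ModelCategory C]

/-- The level weak equivalences of simplicial objects. -/
def levelEquivalences : MorphismProperty (SimplicialObject C) :=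
  fun _ _ f => ∀ n : ℕ, WeakEquivalence (f.app (op ⦋n⦌))

/-- The Reedy cofibrations of simplicial objects. -/
def reedyCofibrations : MorphismProperty (SimplicialObject C) :=
  fun _ _ f => ∀ n : ℕ, Cofibration (relativeLatchingMap n f)

/-- The Reedy fibrations of simplicial objects. -/
def reedyFibrations : MorphismProperty (SimplicialObject C) :=
  fun _ _ f => ∀ n : ℕ, Fibration (relativeMatchingMap n f)

variable {C}

/-- `X` is Reedy fibrant if the map from `X` to the terminal object is a Reedy fibration. -/
def IsReedyFibrant (X : SimplicialObject C) : Prop :=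
  reedyFibrations C (terminal.from X)

/-- `X` is homotopically constant if all face and degeneracy operators are weak equivalences. -/
structure IsHomotopicallyConstant (X : SimplicialObject C) : Prop where
  δ (n : ℕ) (i : Fin (n + 2)) : WeakEquivalence (X.δ i)
  σ (n : ℕ) (i : Fin (n + 1)) : WeakEquivalence (X.σ i)

variable (C) in
/-- A model structure on `sC` is canonical if every level equivalence is a weak equivalence, the
cofibrations are the Reedy cofibrations, and the fibrant objects are the homotopically constant,
Reedy fibrant objects. -/
structure IsCanonicalModelStructure [ModelCategory (SimplicialObject C)] : Prop where
  levelEquivalences_le : levelEquivalences C ≤ weakEquivalences (SimplicialObject C)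
  cofibrations_eq : cofibrations (SimplicialObject C) = reedyCofibrations C
  isFibrant_iff (X : SimplicialObject C) :
    IsFibrant X ↔ IsHomotopicallyConstant X ∧ IsReedyFibrant X

end Reedy

/-! ### Quillen adjunctions and Quillen equivalences -/

section Quillen

variable {D : Type u'} [Category.{v'} D] [ModelCategory C] [ModelCategory D]
  {F : C ⥤ D} {G : D ⥤ C}

/-- An adjunction is a Quillen adjunction if the left adjoint preserves cofibrations and
trivial cofibrations. -/
structure IsQuillenAdjunction (_adj : F ⊣ G) : Prop where
  cofibrations_le : cofibrations C ≤ (cofibrations D).inverseImage F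
  trivialCofibrations_le : trivialCofibrations C ≤ (trivialCofibrations D).inverseImage F

/-- A Quillen adjunction is a Quillen equivalence if the total derived functors, with the derived
adjunction, form an (adjoint) equivalence of homotopy categories. Here the homotopy category of a
model category is its localization at the weak equivalences, the total left derived functor of `F`
is the left derived functor of `C ⥤ D ⥤ Ho D`, the total right derived functor of `G` is the right
derived functor of `D ⥤ C ⥤ Ho C`, and the last two conditions characterize the unit and the counit
of the derived adjunction. -/
structure IsQuillenEquivalence (adj : F ⊣ G) : Prop extends IsQuillenAdjunction adj where
  exists_derived_equivalence :
    ∃ (e : (weakEquivalences C).Localization ≌ (weakEquivalences D).Localization)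
      (α : (weakEquivalences C).Q ⋙ e.functor ⟶ F ⋙ (weakEquivalences D).Q)
      (β : G ⋙ (weakEquivalences C).Q ⟶ (weakEquivalences D).Q ⋙ e.inverse),
      e.functor.IsLeftDerivedFunctor α (weakEquivalences C) ∧
      e.inverse.IsRightDerivedFunctor β (weakEquivalences D) ∧
      (∀ X : C, e.unit.app ((weakEquivalences C).Q.obj X) ≫ e.inverse.map (α.app X) =
        (weakEquivalences C).Q.map (adj.unit.app X) ≫ β.app (F.obj X)) ∧
      (∀ Y : D, e.functor.map (β.app Y) ≫ e.counit.app ((weakEquivalences D).Q.obj Y) =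
        α.app (G.obj Y) ≫ (weakEquivalences D).Q.map (adj.counit.app Y))

end Quillen

/-! ### The adjunction between constant objects and evaluation in degree zero -/

variable (C) in
/-- The functor `Ev : sC ⥤ C`, `X ↦ X₀`. -/
abbrev ev : SimplicialObject C ⥤ C :=
  (evaluation SimplexCategoryᵒᵖ C).obj (op ⦋0⦌)

variable (C) in
/-- The constant object functor is left adjoint to evaluation in degree zero. -/
def constEvAdj : SimplicialObject.const C ⊣ ev C :=
  constantPresheafAdj C SimplexCategory.isTerminalZero

end

end CanonicalModel

/-! The weak equivalences and fibrations of a canonical model structure are not described outright;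
between fibrant objects they are recovered by retract arguments from two facts of Reedy theory. The
lifting fact: lifts exist as soon as all relative latching maps of one map lift against the relative
matching maps of the other in the same degree. The factorization fact, `exists_reedy_factorization`:
factorizations in `C` yield factorizations in `sC` that are controlled by relative latching and
matching maps.

A canonical trivial fibration lifts against Reedy cofibrations, so it is a retract of a map whose
relative matching maps are trivial fibrations, hence it is a trivial fibration in each degree.
Brown's factorization then turns weak equivalences between fibrant objects into level equivalences.
A Reedy cofibration that is a level equivalence has trivial cofibrations as relative latching maps,
so it lifts against Reedy fibrations; with the retract argument this compares the two kinds of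
fibrations.

For the Quillen equivalence, `c` preserves weak equivalences, and the counit at a homotopically
constant object is a level equivalence. Reedy fibrant replacement of `cA` along a level equivalence
stays homotopically constant, so it is a canonical fibrant replacement, and the derived unit is its
component in degree zero.

Factorizations are built from the target by changing one degree at a time, with higher degrees
determined by matching data; the limit of the resulting tower is constant in each degree from some
stage on. Well-definedness of forced values rests on `exists_connected_factorization`:
factorizations of a map through lower degrees are all linked to its epi-mono factorization. -/

namespace CanonicalModel

/-! ### Lifting in functor categories by induction on the degree -/

section DegreewiseLifting

universe w w'

variable {J : Type w} [Category.{w'} J] (deg : J → ℕ) {E : Type u} [Category.{v} E]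

/-- Any morphism between two objects of the same degree is an identity or factors through an object
of lower degree. -/
def FactorsThroughLowerDegree : Prop :=
  ∀ ⦃i j : J⦄ (f : i ⟶ j), deg i = deg j → (∃ h : i = j, f = eqToHom h) ∨
    ∃ (k : J) (a : i ⟶ k) (b : k ⟶ j), deg k < deg i ∧ a ≫ b = f

variable {X Y Z W : J ⥤ E}

/-- Solutions of a lifting problem between natural transformations, defined in degrees `< n`. -/
@[ext]
structure PartialLift {f : X ⟶ Y} {g : Z ⟶ W} {a : X ⟶ Z} {b : Y ⟶ W} (sq : CommSq a f g b)
    (n : ℕ) where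
  /-- the components of the partial lifting -/
  app (i : J) (hi : deg i < n) : Y.obj i ⟶ Z.obj i
  naturality (i j : J) (hi : deg i < n) (hj : deg j < n) (h : i ⟶ j) :
    Y.map h ≫ app j hj = app i hi ≫ Z.map h
  fac_left (i : J) (hi : deg i < n) : f.app i ≫ app i hi = a.app i
  fac_right (i : J) (hi : deg i < n) : app i hi ≫ g.app i = b.app i

/-- Any partial solution in degrees `< deg j` of a lifting problem extends to the object `j`. -/
def ExtendsLifts (f : X ⟶ Y) (g : Z ⟶ W) (j : J) : Prop :=
  ∀ ⦃a : X ⟶ Z⦄ ⦃b : Y ⟶ W⦄ (sq : CommSq a f g b) (u : PartialLift deg sq (deg j)),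
    ∃ φ : Y.obj j ⟶ Z.obj j, f.app j ≫ φ = a.app j ∧ φ ≫ g.app j = b.app j ∧
      (∀ (i : J) (hi : deg i < deg j) (h : i ⟶ j), Y.map h ≫ φ = u.app i hi ≫ Z.map h) ∧
      (∀ (k : J) (hk : deg k < deg j) (h : j ⟶ k), φ ≫ Z.map h = Y.map h ≫ u.app k hk)

variable {deg}

namespace PartialLift

variable {f : X ⟶ Y} {g : Z ⟶ W} {a : X ⟶ Z} {b : Y ⟶ W} {sq : CommSq a f g b}

/-- The objects of degree `n` can be treated independently: a map between two of them is an identity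
or passes through lower degree, where naturality follows from the two compatibilities in
`ExtendsLifts`. -/
lemma exists_extension (hJ : FactorsThroughLowerDegree deg) (H : ∀ j, ExtendsLifts deg f g j)
    {n : ℕ} (u : PartialLift deg sq n) :
    ∃ u' : PartialLift deg sq (n + 1), ∀ i hi, u'.app i (Nat.lt_succ_of_lt hi) = u.app i hi := by
  have H' (j : J) (hj : deg j = n) : ∃ φ : Y.obj j ⟶ Z.obj j,
      f.app j ≫ φ = a.app j ∧ φ ≫ g.app j = b.app j ∧
      (∀ (i : J) (hi : deg i < n) (h : i ⟶ j), Y.map h ≫ φ = u.app i hi ≫ Z.map h) ∧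
      (∀ (k : J) (hk : deg k < n) (h : j ⟶ k), φ ≫ Z.map h = Y.map h ≫ u.app k hk) := by
    subst hj
    exact H j sq u
  choose φ hφ₁ hφ₂ hφ₃ hφ₄ using H'
  have eq_of_not_lt {i : J} (hi : deg i < n + 1) (hi' : ¬ deg i < n) : deg i = n := by omega
  refine ⟨{
    app := fun i hi => if h : deg i < n then u.app i h else φ i (eq_of_not_lt hi h)
    naturality := fun i j hi hj h => ?_
    fac_left := fun i hi => ?_
    fac_right := fun i hi => ?_ }, fun i hi => dif_pos hi⟩
  · by_cases hi' : deg i < n <;> by_cases hj' : deg j < n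
    · simpa [hi', hj'] using u.naturality i j hi' hj' h
    · simpa [hi', hj'] using hφ₃ j _ i hi' h
    · simpa [hi', hj'] using (hφ₄ i _ j hj' h).symm
    · have hi := eq_of_not_lt hi hi'
      have hj := eq_of_not_lt hj hj'
      simp only [hi', hj', dite_false]
      obtain ⟨rfl, rfl⟩ | ⟨k, α, β, hk, rfl⟩ := hJ h (hi.trans hj.symm)
      · simp
      · rw [Y.map_comp, Z.map_comp, Category.assoc, hφ₃ j hj k (by omega) β,
          ← Category.assoc, ← Category.assoc, hφ₄ i hi k (by omega) α]
  · by_cases hi' : deg i < n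
    · simpa [hi'] using u.fac_left i hi'
    · simpa [hi'] using hφ₁ i _
  · by_cases hi' : deg i < n
    · simpa [hi'] using u.fac_right i hi'
    · simpa [hi'] using hφ₂ i _

end PartialLift

theorem hasLiftingProperty_of_extendsLifts (hJ : FactorsThroughLowerDegree deg)
    (f : X ⟶ Y) (g : Z ⟶ W) (H : ∀ j, ExtendsLifts deg f g j) : HasLiftingProperty f g where
  sq_hasLift {a b} sq := by
    choose next hnext using fun (n : ℕ) (u : PartialLift deg sq n) =>
      u.exists_extension hJ H
    -- There is nothing to define in degrees `< 0`, so the recursion starts from the empty lift.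
    let u (n : ℕ) : PartialLift deg sq n := n.rec
      { app _ hi := by simp at hi
        naturality _ _ hi := by simp at hi
        fac_left _ hi := by simp at hi
        fac_right _ hi := by simp at hi } next
    have hu (n m : ℕ) (hnm : n ≤ m) (i : J) (hi : deg i < n) :
        (u m).app i (hi.trans_le hnm) = (u n).app i hi := by
      induction m, hnm using Nat.le_induction with
      | base => rfl
      | succ m hm hm' => exact (hnext m (u m) i _).trans hm'
    exact ⟨⟨{
      l :=
        { app i := (u (deg i + 1)).app i (by simp)
          naturality i j h := by
            -- Components at `i` and `j` come from different stages; both are moved to one stage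
            -- that covers the two degrees.
            rw [← hu (deg i + 1) (deg i + deg j + 1) (by omega) i (by omega),
              ← hu (deg j + 1) (deg i + deg j + 1) (by omega) j (by omega)]
            exact (u _).naturality _ _ _ _ h }
      fac_left := by ext i; exact (u (deg i + 1)).fac_left i (by simp)
      fac_right := by ext i; exact (u (deg i + 1)).fac_right i (by simp) }⟩⟩

end DegreewiseLifting

/-! ### Factorizations in the simplex category -/

section SimplexCategory

/-- The degree of an object of `Δᵒᵖ`. -/
abbrev degree (a : SimplexCategoryᵒᵖ) : ℕ := a.unop.len

/-- Any factorization of a morphism `f` of `Δᵒᵖ` is connected to the Reedy factorization of `f` by a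
zigzag of factorizations through objects of lower degree. -/
lemma exists_connected_factorization {a b : SimplexCategoryᵒᵖ} (f : a ⟶ b) :
    ∃ (c : SimplexCategoryᵒᵖ) (α₀ : a ⟶ c) (β₀ : c ⟶ b), α₀ ≫ β₀ = f ∧
      ∀ (j : SimplexCategoryᵒᵖ) (α : a ⟶ j) (β : j ⟶ b), α ≫ β = f →
        ∃ (k : SimplexCategoryᵒᵖ) (s : j ⟶ k) (t : c ⟶ k) (γ : k ⟶ b),
          α ≫ s = α₀ ≫ t ∧ s ≫ γ = β ∧ t ≫ γ = β₀ ∧ degree k ≤ degree j ∧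
            degree c ≤ degree k := by
  -- Passing to `Δ` reverses arrows: the epi part of `f.unop` becomes the second map and the mono
  -- part the first.
  refine ⟨op (image f.unop), (image.ι f.unop).op, (factorThruImage f.unop).op, ?_, ?_⟩
  · rw [← op_comp, image.fac, Quiver.Hom.op_unop]
  · rintro j α β rfl
    -- The linking object is the image of `β.unop`. Factoring the rest of the map into an epi and a
    -- mono gives an epi-mono factorization of the whole, which must be the chosen one.
    let e := factorThruImage β.unop
    let m := image.ι β.unop
    let e' := factorThruImage (m ≫ α.unop)
    let m' := image.ι (m ≫ α.unop)
    have fac : (e ≫ e') ≫ m' = (α ≫ β).unop := by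
      simp [e, e', m, m']
    have him := SimplexCategory.image_eq fac
    revert fac
    -- The two images are equal as objects because `Δ` is skeletal; the maps are generalized so that
    -- this equality can be rewritten in their types.
    generalize he' : e' = e''
    generalize hm' : m' = m''
    have hepi : Epi e'' := by subst he'; infer_instance
    have hmono : Mono m'' := by subst hm'; infer_instance
    have hc : m ≫ α.unop = e'' ≫ m'' := by
      rw [← he', ← hm']; simp [e', m']
    clear he' hm'
    clear_value e' m'
    revert e'' m''
    rw [← him]
    intro e'' m'' _ _ hc fac
    refine ⟨op (image β.unop), m.op, e''.op, e.op, ?_, ?_, ?_, ?_, ?_⟩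
    · rw [SimplexCategory.image_ι_eq fac, ← op_comp, ← hc]
      simp
    · simp [e, m, ← op_comp]
    · rw [SimplexCategory.factorThruImage_eq fac, op_comp]
    · exact SimplexCategory.len_le_of_mono m
    · exact SimplexCategory.len_le_of_epi e''

lemma isIso_of_epi_of_eq {x y : SimplexCategory} (h : x = y) (e : x ⟶ y) [Epi e] : IsIso e := by
  subst h
  rw [SimplexCategory.eq_id_of_epi e]
  infer_instance

/-- Between objects of equal degree, a mono of `Δ` is an identity, and the image of a map that is
not mono has smaller degree. -/
lemma eqToHom_or_exists_factorization {a b : SimplexCategoryᵒᵖ} (f : a ⟶ b)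
    (hab : degree a = degree b) :
    (∃ h : a = b, f = eqToHom h) ∨
      ∃ (c : SimplexCategoryᵒᵖ) (α : a ⟶ c) (β : c ⟶ b), degree c < degree a ∧ α ≫ β = f := by
  obtain rfl : a = b := Opposite.unop_injective (SimplexCategory.ext hab)
  by_cases hf : Mono f.unop
  · exact Or.inl ⟨rfl, Quiver.Hom.unop_inj (SimplexCategory.eq_id_of_mono f.unop)⟩
  · refine Or.inr ⟨op (image f.unop), (image.ι f.unop).op, (factorThruImage f.unop).op, ?_, ?_⟩
    · refine SimplexCategory.len_lt_of_mono (image.ι f.unop) (fun h => hf ?_)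
      have := isIso_of_epi_of_eq h (factorThruImage f.unop)
      rw [← image.fac f.unop]
      infer_instance
    · rw [← op_comp, image.fac, Quiver.Hom.op_unop]

lemma factorsThroughLowerDegree_degree : FactorsThroughLowerDegree degree :=
  fun _ _ f h => eqToHom_or_exists_factorization f h

end SimplexCategory

end CanonicalModel

/-! ### Reedy lifting arguments through latching and matching objects. -/

namespace CanonicalModel

noncomputable section

variable {C : Type u} [Category.{v} C]

/-! ### Latching and matching objects -/

section

variable [HasFiniteColimits C]

/-- The canonical morphism to the latching object `Lₙ X` that is attached to a map `[i] ⟶ [n]`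
of `Δᵒᵖ` with `i < n`. -/
def latchingι (n : ℕ) (X : SimplicialObject C) {i : SimplexCategoryᵒᵖ} (hi : degree i < n)
    (β : i ⟶ op ⦋n⦌) : X.obj i ⟶ latchingObj n X :=
  colimit.ι (latchingForget n ⋙ X) ⟨Over.mk β, hi⟩

variable {n : ℕ} {X Y : SimplicialObject C}

lemma map_latchingι {i j : SimplexCategoryᵒᵖ} (hi : degree i < n) (hj : degree j < n) (h : i ⟶ j)
    (β : j ⟶ op ⦋n⦌) : X.map h ≫ latchingι n X hj β = latchingι n X hi (h ≫ β) :=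
  colimit.w (latchingForget n ⋙ X)
    (⟨Over.homMk h⟩ : (⟨Over.mk (h ≫ β), hi⟩ : LatchingCategory n) ⟶ ⟨Over.mk β, hj⟩)

lemma map_latchingι_assoc {i j : SimplexCategoryᵒᵖ} (hi : degree i < n) (hj : degree j < n)
    (h : i ⟶ j) (β : j ⟶ op ⦋n⦌) {A : C} (a : latchingObj n X ⟶ A) :
    X.map h ≫ latchingι n X hj β ≫ a = latchingι n X hi (h ≫ β) ≫ a := by
  rw [← map_latchingι hi hj, Category.assoc]

@[simp]
lemma latchingι_latchingMap {i : SimplexCategoryᵒᵖ} (hi : degree i < n) (β : i ⟶ op ⦋n⦌) :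
    latchingι n X hi β ≫ latchingMap n X = X.map β :=
  ι_latchingMap n X ⟨Over.mk β, hi⟩

@[simp]
lemma latchingι_latchingMap_assoc {i : SimplexCategoryᵒᵖ} (hi : degree i < n) (β : i ⟶ op ⦋n⦌)
    {A : C} (a : X.obj (op ⦋n⦌) ⟶ A) :
    latchingι n X hi β ≫ latchingMap n X ≫ a = X.map β ≫ a := by
  rw [← Category.assoc, latchingι_latchingMap]

@[simp]
lemma latchingι_latchingObjMap {i : SimplexCategoryᵒᵖ} (hi : degree i < n) (β : i ⟶ op ⦋n⦌)
    (f : X ⟶ Y) :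
    latchingι n X hi β ≫ latchingObjMap n f = f.app i ≫ latchingι n Y hi β :=
  ι_latchingObjMap n f ⟨Over.mk β, hi⟩

@[simp]
lemma latchingι_latchingObjMap_assoc {i : SimplexCategoryᵒᵖ} (hi : degree i < n) (β : i ⟶ op ⦋n⦌)
    (f : X ⟶ Y) {A : C} (a : latchingObj n Y ⟶ A) :
    latchingι n X hi β ≫ latchingObjMap n f ≫ a = f.app i ≫ latchingι n Y hi β ≫ a := by
  rw [← Category.assoc, latchingι_latchingObjMap, Category.assoc]

lemma latchingObj_hom_ext {A : C} {l l' : latchingObj n X ⟶ A}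
    (h : ∀ (i : SimplexCategoryᵒᵖ) (hi : degree i < n) (β : i ⟶ op ⦋n⦌),
      latchingι n X hi β ≫ l = latchingι n X hi β ≫ l') : l = l' := by
  refine colimit.hom_ext ?_
  rintro ⟨⟨i, ⟨⟨⟩⟩, β⟩, hi⟩
  exact h i hi β

/-- Constructor for morphisms from a latching object. -/
def latchingObjDesc {A : C}
    (u : ∀ (i : SimplexCategoryᵒᵖ), degree i < n → (i ⟶ op ⦋n⦌) → (X.obj i ⟶ A))
    (hu : ∀ (i j : SimplexCategoryᵒᵖ) (hi : degree i < n) (hj : degree j < n) (h : i ⟶ j)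
      (β : j ⟶ op ⦋n⦌), X.map h ≫ u j hj β = u i hi (h ≫ β)) : latchingObj n X ⟶ A :=
  colimit.desc (latchingForget n ⋙ X) (Cocone.mk A
    { app := fun j => u j.obj.left j.property j.obj.hom
      naturality := fun i j h => by
        have := hu i.obj.left j.obj.left i.property j.property h.hom.left j.obj.hom
        simpa using this })

@[simp]
lemma latchingι_latchingObjDesc {A : C}
    (u : ∀ (i : SimplexCategoryᵒᵖ), degree i < n → (i ⟶ op ⦋n⦌) → (X.obj i ⟶ A))
    (hu : ∀ (i j : SimplexCategoryᵒᵖ) (hi : degree i < n) (hj : degree j < n) (h : i ⟶ j)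
      (β : j ⟶ op ⦋n⦌), X.map h ≫ u j hj β = u i hi (h ≫ β))
    {i : SimplexCategoryᵒᵖ} (hi : degree i < n) (β : i ⟶ op ⦋n⦌) :
    latchingι n X hi β ≫ latchingObjDesc u hu = u i hi β :=
  colimit.ι_desc _ _

@[simp]
lemma latchingι_latchingObjDesc_assoc {A : C}
    (u : ∀ (i : SimplexCategoryᵒᵖ), degree i < n → (i ⟶ op ⦋n⦌) → (X.obj i ⟶ A))
    (hu : ∀ (i j : SimplexCategoryᵒᵖ) (hi : degree i < n) (hj : degree j < n) (h : i ⟶ j)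
      (β : j ⟶ op ⦋n⦌), X.map h ≫ u j hj β = u i hi (h ≫ β))
    {i : SimplexCategoryᵒᵖ} (hi : degree i < n) (β : i ⟶ op ⦋n⦌) {B : C} (a : A ⟶ B) :
    latchingι n X hi β ≫ latchingObjDesc u hu ≫ a = u i hi β ≫ a := by
  rw [← Category.assoc, latchingι_latchingObjDesc]

@[simp]
lemma inl_relativeLatchingMap (f : X ⟶ Y) :
    pushout.inl _ _ ≫ relativeLatchingMap n f = f.app _ :=
  pushout.inl_desc _ _ _

@[simp]
lemma inl_relativeLatchingMap_assoc (f : X ⟶ Y) {A : C} (a : Y.obj (op ⦋n⦌) ⟶ A) :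
    pushout.inl _ _ ≫ relativeLatchingMap n f ≫ a = f.app _ ≫ a := by
  rw [← Category.assoc, inl_relativeLatchingMap]

@[simp]
lemma inr_relativeLatchingMap (f : X ⟶ Y) :
    pushout.inr _ _ ≫ relativeLatchingMap n f = latchingMap n Y :=
  pushout.inr_desc _ _ _

@[simp]
lemma inr_relativeLatchingMap_assoc (f : X ⟶ Y) {A : C} (a : Y.obj (op ⦋n⦌) ⟶ A) :
    pushout.inr _ _ ≫ relativeLatchingMap n f ≫ a = latchingMap n Y ≫ a := by
  rw [← Category.assoc, inr_relativeLatchingMap]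

end

section

variable [HasFiniteLimits C]

/-- The canonical morphism from the matching object `Mₙ X` that is attached to a map `[n] ⟶ [i]`
of `Δᵒᵖ` with `i < n`. -/
def matchingπ (n : ℕ) (X : SimplicialObject C) {i : SimplexCategoryᵒᵖ} (hi : degree i < n)
    (α : op ⦋n⦌ ⟶ i) : matchingObj n X ⟶ X.obj i :=
  limit.π (matchingForget n ⋙ X) ⟨Under.mk α, hi⟩

variable {n : ℕ} {X Y : SimplicialObject C}

lemma matchingπ_map {i j : SimplexCategoryᵒᵖ} (hi : degree i < n) (hj : degree j < n)
    (α : op ⦋n⦌ ⟶ i) (h : i ⟶ j) :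
    matchingπ n X hi α ≫ X.map h = matchingπ n X hj (α ≫ h) :=
  limit.w (matchingForget n ⋙ X) (j := ⟨Under.mk α, hi⟩) (j' := ⟨Under.mk (α ≫ h), hj⟩)
    ⟨Under.homMk h⟩

@[simp]
lemma matchingMap_matchingπ {i : SimplexCategoryᵒᵖ} (hi : degree i < n) (α : op ⦋n⦌ ⟶ i) :
    matchingMap n X ≫ matchingπ n X hi α = X.map α :=
  matchingMap_π n X ⟨Under.mk α, hi⟩

@[simp]
lemma matchingObjMap_matchingπ {i : SimplexCategoryᵒᵖ} (hi : degree i < n) (α : op ⦋n⦌ ⟶ i)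
    (f : X ⟶ Y) :
    matchingObjMap n f ≫ matchingπ n Y hi α = matchingπ n X hi α ≫ f.app i :=
  matchingObjMap_π n f ⟨Under.mk α, hi⟩

lemma matchingObj_hom_ext {A : C} {l l' : A ⟶ matchingObj n X}
    (h : ∀ (i : SimplexCategoryᵒᵖ) (hi : degree i < n) (α : op ⦋n⦌ ⟶ i),
      l ≫ matchingπ n X hi α = l' ≫ matchingπ n X hi α) : l = l' := by
  refine limit.hom_ext ?_
  rintro ⟨⟨⟨⟨⟩⟩, i, α⟩, hi⟩
  exact h i hi α

/-- Constructor for morphisms to a matching object. -/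
def matchingObjLift {A : C}
    (u : ∀ (i : SimplexCategoryᵒᵖ), degree i < n → (op ⦋n⦌ ⟶ i) → (A ⟶ X.obj i))
    (hu : ∀ (i j : SimplexCategoryᵒᵖ) (hi : degree i < n) (hj : degree j < n) (h : i ⟶ j)
      (α : op ⦋n⦌ ⟶ i), u i hi α ≫ X.map h = u j hj (α ≫ h)) : A ⟶ matchingObj n X :=
  limit.lift (matchingForget n ⋙ X) (Cone.mk A
    { app := fun j => u j.obj.right j.property j.obj.hom
      naturality := fun i j h => by
        have := hu i.obj.right j.obj.right i.property j.property h.hom.right i.obj.hom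
        simpa using this.symm })

@[simp]
lemma matchingObjLift_matchingπ {A : C}
    (u : ∀ (i : SimplexCategoryᵒᵖ), degree i < n → (op ⦋n⦌ ⟶ i) → (A ⟶ X.obj i))
    (hu : ∀ (i j : SimplexCategoryᵒᵖ) (hi : degree i < n) (hj : degree j < n) (h : i ⟶ j)
      (α : op ⦋n⦌ ⟶ i), u i hi α ≫ X.map h = u j hj (α ≫ h))
    {i : SimplexCategoryᵒᵖ} (hi : degree i < n) (α : op ⦋n⦌ ⟶ i) :
    matchingObjLift u hu ≫ matchingπ n X hi α = u i hi α :=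
  limit.lift_π _ _

@[simp]
lemma relativeMatchingMap_fst (f : X ⟶ Y) :
    relativeMatchingMap n f ≫ pullback.fst _ _ = f.app _ :=
  pullback.lift_fst _ _ _

@[simp]
lemma relativeMatchingMap_snd (f : X ⟶ Y) :
    relativeMatchingMap n f ≫ pullback.snd _ _ = matchingMap n X :=
  pullback.lift_snd _ _ _

end

/-! ### Lifting properties and relative latching and matching maps -/

section

variable [HasFiniteColimits C] {X Y : SimplicialObject C} (f : X ⟶ Y) (n : ℕ)

/-- This unwinds the pushout and the colimit: a lift against `relativeLatchingMap` is an extension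
over `Yₙ` of a map on `Xₙ` and a compatible family `u` on the lower degrees. -/
lemma exists_lift_of_relativeLatchingMap {A B : C} (p : A ⟶ B)
    [HasLiftingProperty (relativeLatchingMap n f) p]
    (a : X.obj (op ⦋n⦌) ⟶ A) (b : Y.obj (op ⦋n⦌) ⟶ B)
    (u : ∀ (i : SimplexCategoryᵒᵖ), degree i < n → (i ⟶ op ⦋n⦌) → (Y.obj i ⟶ A))
    (hu : ∀ (i j : SimplexCategoryᵒᵖ) (hi : degree i < n) (hj : degree j < n) (h : i ⟶ j)
      (β : j ⟶ op ⦋n⦌), Y.map h ≫ u j hj β = u i hi (h ≫ β))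
    (hab : a ≫ p = f.app _ ≫ b)
    (hua : ∀ i hi β, f.app i ≫ u i hi β = X.map β ≫ a)
    (hub : ∀ i hi β, u i hi β ≫ p = Y.map β ≫ b) :
    ∃ φ : Y.obj (op ⦋n⦌) ⟶ A, f.app _ ≫ φ = a ∧ φ ≫ p = b ∧
      ∀ i hi β, Y.map β ≫ φ = u i hi β := by
  have sq : CommSq (pushout.desc (f := latchingMap n X) (g := latchingObjMap n f) a
      (latchingObjDesc u hu) (latchingObj_hom_ext (by simp [hua])))
      (relativeLatchingMap n f) p b := ⟨by
    apply pushout.hom_ext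
    · simp [pushout.inl_desc_assoc, hab]
    · exact latchingObj_hom_ext (by simp [pushout.inr_desc_assoc, hub])⟩
  refine ⟨sq.lift, ?_, sq.fac_right, fun i hi β => ?_⟩
  · rw [← inl_relativeLatchingMap_assoc, sq.fac_left, pushout.inl_desc]
  · rw [← latchingι_latchingMap_assoc hi β, ← inr_relativeLatchingMap_assoc, sq.fac_left,
      pushout.inr_desc, latchingι_latchingObjDesc]

end

section

variable [HasFiniteLimits C] {X Y : SimplicialObject C} (f : X ⟶ Y) (n : ℕ)

lemma exists_lift_of_relativeMatchingMap {A B : C} (i : A ⟶ B)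
    [HasLiftingProperty i (relativeMatchingMap n f)]
    (a : A ⟶ X.obj (op ⦋n⦌)) (b : B ⟶ Y.obj (op ⦋n⦌))
    (u : ∀ (k : SimplexCategoryᵒᵖ), degree k < n → (op ⦋n⦌ ⟶ k) → (B ⟶ X.obj k))
    (hu : ∀ (k j : SimplexCategoryᵒᵖ) (hk : degree k < n) (hj : degree j < n) (h : k ⟶ j)
      (α : op ⦋n⦌ ⟶ k), u k hk α ≫ X.map h = u j hj (α ≫ h))
    (hab : a ≫ f.app _ = i ≫ b)
    (hua : ∀ k hk α, i ≫ u k hk α = a ≫ X.map α)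
    (hub : ∀ k hk α, u k hk α ≫ f.app k = b ≫ Y.map α) :
    ∃ φ : B ⟶ X.obj (op ⦋n⦌), i ≫ φ = a ∧ φ ≫ f.app _ = b ∧
      ∀ k hk α, φ ≫ X.map α = u k hk α := by
  have sq : CommSq a i (relativeMatchingMap n f)
      (pullback.lift (f := matchingMap n Y) (g := matchingObjMap n f) b
        (matchingObjLift u hu) (matchingObj_hom_ext fun k hk α => by
          rw [Category.assoc, Category.assoc, matchingMap_matchingπ, matchingObjMap_matchingπ,
            ← Category.assoc, matchingObjLift_matchingπ, hub])) := ⟨by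
    apply pullback.hom_ext
    · simp [hab, pullback.lift_fst]
    · exact matchingObj_hom_ext (by simp [hua, pullback.lift_snd_assoc])⟩
  refine ⟨sq.lift, sq.fac_left, ?_, fun k hk α => ?_⟩
  · rw [← relativeMatchingMap_fst, sq.fac_right_assoc, pullback.lift_fst]
  · rw [← matchingMap_matchingπ hk α, ← relativeMatchingMap_snd f, Category.assoc,
      sq.fac_right_assoc, pullback.lift_snd_assoc, matchingObjLift_matchingπ]

end

section

variable [HasFiniteColimits C] [HasFiniteLimits C]

/-- The Reedy lifting lemma. -/
theorem hasLiftingProperty_of_relativeLatchingMap_of_relativeMatchingMap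
    {X Y Z W : SimplicialObject C} (f : X ⟶ Y) (g : Z ⟶ W)
    (H : ∀ n, HasLiftingProperty (relativeLatchingMap n f) (relativeMatchingMap n g)) :
    HasLiftingProperty f g := by
  refine hasLiftingProperty_of_extendsLifts factorsThroughLowerDegree_degree f g ?_
  rintro ⟨⟨n⟩⟩ a b sq u
  have sqw (k) : a.app k ≫ g.app k = f.app k ≫ b.app k := congr_app sq.w k
  -- Maps from `[n]` to lower degrees force the matching part `l` of the new component, and maps
  -- from lower degrees to `[n]` force its restriction to the latching object. A single lift of the
  -- relative latching map against the relative matching map meets both demands.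
  let l : Y.obj (op ⦋n⦌) ⟶ matchingObj n Z :=
    matchingObjLift (fun i hi α => Y.map α ≫ u.app i hi) (fun i j hi hj h α => by
      rw [Category.assoc, ← u.naturality i j hi hj h, Y.map_comp, Category.assoc])
  have hl (i : SimplexCategoryᵒᵖ) (hi : degree i < n) (α : op ⦋n⦌ ⟶ i) :
      l ≫ matchingπ n Z hi α = Y.map α ≫ u.app i hi := matchingObjLift_matchingπ _ _ _ _
  have hlb : b.app _ ≫ matchingMap n W = l ≫ matchingObjMap n g :=
    matchingObj_hom_ext fun i hi α => by
      rw [Category.assoc, Category.assoc, matchingMap_matchingπ, matchingObjMap_matchingπ,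
        ← Category.assoc, hl, Category.assoc, u.fac_right, b.naturality]
  obtain ⟨φ, h₁, h₂, h₃⟩ := exists_lift_of_relativeLatchingMap f n (relativeMatchingMap n g)
    (a.app _) (pullback.lift (b.app _) l hlb)
    (fun i hi β => u.app i hi ≫ Z.map β) (fun i j hi hj h β => by
      rw [← Category.assoc, u.naturality i j hi hj h, Category.assoc, Z.map_comp]) (by
      apply pullback.hom_ext
      · simp [sqw, pullback.lift_fst]
      · refine matchingObj_hom_ext fun i hi α => ?_
        simp only [Category.assoc, relativeMatchingMap_snd, pullback.lift_snd,
          matchingMap_matchingπ, hl]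
        rw [← f.naturality_assoc, u.fac_left, a.naturality]) (fun i hi β => by
      rw [← Category.assoc, u.fac_left i hi, a.naturality]) (fun i hi β => by
      apply pullback.hom_ext
      · simp only [Category.assoc, relativeMatchingMap_fst, pullback.lift_fst]
        rw [b.naturality, g.naturality, ← Category.assoc, u.fac_right i hi]
      · refine matchingObj_hom_ext fun j hj α => ?_
        simp only [Category.assoc, relativeMatchingMap_snd, pullback.lift_snd,
          matchingMap_matchingπ, hl]
        rw [← Y.map_comp_assoc, ← Z.map_comp, u.naturality])
  refine ⟨φ, h₁, ?_, fun i hi h => h₃ i hi h, fun k hk h => ?_⟩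
  · rw [← relativeMatchingMap_fst, ← Category.assoc, h₂, pullback.lift_fst]
  · rw [← matchingMap_matchingπ hk h, ← relativeMatchingMap_snd g, Category.assoc,
      ← Category.assoc, h₂, pullback.lift_snd_assoc, hl]

end

/-! ### Lifting properties of the maps between latching and matching objects -/

section

variable [HasFiniteColimits C] {X Y : SimplicialObject C} (f : X ⟶ Y) (n : ℕ)

lemma factorsThroughLowerDegree_latchingCategory :
    FactorsThroughLowerDegree (fun g : LatchingCategory n => degree g.obj.left) := by
  rintro ⟨⟨a, ⟨⟨⟩⟩, α⟩, ha⟩ ⟨⟨b, ⟨⟨⟩⟩, β⟩, hb⟩ h hab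
  have hw := Over.w h.hom
  obtain ⟨h', hh'⟩ | ⟨c, s, t, hc, fac⟩ := eqToHom_or_exists_factorization h.hom.left hab
  · change a = b at h'
    subst h'
    rw [hh'] at hw
    obtain rfl : β = α := by simpa using hw
    refine Or.inl ⟨rfl, ?_⟩
    apply InducedCategory.hom_ext
    apply Over.OverMorphism.ext
    exact hh'
  · refine Or.inr ⟨⟨Over.mk (t ≫ β), hc.trans ha⟩, ⟨Over.homMk s ?_⟩, ⟨Over.homMk t rfl⟩, hc, ?_⟩
    · dsimp at fac hw ⊢
      rw [← hw, ← fac, Category.assoc]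
    · apply InducedCategory.hom_ext
      apply Over.OverMorphism.ext
      exact fac

/-- By the adjunction between colimits and constant diagrams, this is a lifting problem of diagrams
on `𝓛ₙ`, solved degree by degree. Over `g : [k] ⟶ [n]` the incoming maps of lower degree form the
latching data of degree `k < n`. -/
theorem hasLiftingProperty_latchingObjMap {A B : C} (p : A ⟶ B)
    (H : ∀ m < n, HasLiftingProperty (relativeLatchingMap m f) p) :
    HasLiftingProperty (latchingObjMap n f) p := by
  refine (colimConstAdj.hasLiftingProperty_iff (Functor.whiskerLeft (latchingForget n) f) p).2 ?_
  refine hasLiftingProperty_of_extendsLifts (factorsThroughLowerDegree_latchingCategory n) _ _ ?_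
  rintro ⟨⟨⟨⟨k⟩⟩, ⟨⟨⟩⟩, g⟩, hk⟩ a b sq u
  change op ⦋k⦌ ⟶ op ⦋n⦌ at g
  change k < n at hk
  let a' {i : SimplexCategoryᵒᵖ} (hi : degree i < n) (β : i ⟶ op ⦋n⦌) : X.obj i ⟶ A :=
    a.app ⟨Over.mk β, hi⟩
  let b' {i : SimplexCategoryᵒᵖ} (hi : degree i < n) (β : i ⟶ op ⦋n⦌) : Y.obj i ⟶ B :=
    b.app ⟨Over.mk β, hi⟩
  let u' {i : SimplexCategoryᵒᵖ} (hi : degree i < k) (β : i ⟶ op ⦋n⦌) : Y.obj i ⟶ A :=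
    u.app ⟨Over.mk β, hi.trans hk⟩ hi
  have ha' {i j : SimplexCategoryᵒᵖ} (hi : degree i < n) (hj : degree j < n) (h : i ⟶ j)
      (β : j ⟶ op ⦋n⦌) : X.map h ≫ a' hj β = a' hi (h ≫ β) :=
    (a.naturality (X := ⟨Over.mk (h ≫ β), hi⟩) (Y := ⟨Over.mk β, hj⟩) ⟨Over.homMk h⟩).trans
      (Category.comp_id _)
  have hb' {i j : SimplexCategoryᵒᵖ} (hi : degree i < n) (hj : degree j < n) (h : i ⟶ j)
      (β : j ⟶ op ⦋n⦌) : Y.map h ≫ b' hj β = b' hi (h ≫ β) :=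
    (b.naturality (X := ⟨Over.mk (h ≫ β), hi⟩) (Y := ⟨Over.mk β, hj⟩) ⟨Over.homMk h⟩).trans
      (Category.comp_id _)
  have hu' {i j : SimplexCategoryᵒᵖ} (hi : degree i < k) (hj : degree j < k) (h : i ⟶ j)
      (β : j ⟶ op ⦋n⦌) : Y.map h ≫ u' hj β = u' hi (h ≫ β) :=
    (u.naturality ⟨Over.mk (h ≫ β), hi.trans hk⟩ ⟨Over.mk β, hj.trans hk⟩ hi hj
      ⟨Over.homMk h⟩).trans (Category.comp_id _)
  have hab {i : SimplexCategoryᵒᵖ} (hi : degree i < n) (β : i ⟶ op ⦋n⦌) :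
      a' hi β ≫ p = f.app i ≫ b' hi β := congr_app sq.w ⟨Over.mk β, hi⟩
  have hua {i : SimplexCategoryᵒᵖ} (hi : degree i < k) (β : i ⟶ op ⦋n⦌) :
      f.app i ≫ u' hi β = a' (hi.trans hk) β := u.fac_left ⟨Over.mk β, hi.trans hk⟩ hi
  have hub {i : SimplexCategoryᵒᵖ} (hi : degree i < k) (β : i ⟶ op ⦋n⦌) :
      u' hi β ≫ p = b' (hi.trans hk) β := u.fac_right ⟨Over.mk β, hi.trans hk⟩ hi
  have key : ∃ φ : Y.obj (op ⦋k⦌) ⟶ A, f.app _ ≫ φ = a' hk g ∧ φ ≫ p = b' hk g ∧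
      (∀ (i : SimplexCategoryᵒᵖ) (hi : degree i < k) (h : i ⟶ op ⦋k⦌),
        Y.map h ≫ φ = u' hi (h ≫ g)) ∧
      (∀ (j : SimplexCategoryᵒᵖ) (hj : degree j < k) (α : op ⦋k⦌ ⟶ j) (β : j ⟶ op ⦋n⦌),
        α ≫ β = g → φ = Y.map α ≫ u' hj β) := by
    -- If `g` factors through lower degree, the value is forced, and connectedness makes it
    -- independent of the factorization. Otherwise no map leads from `g` to lower degree, and the
    -- relative latching map provides the value.
    by_cases hg : ∃ (j : SimplexCategoryᵒᵖ) (α : op ⦋k⦌ ⟶ j) (β : j ⟶ op ⦋n⦌),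
      degree j < k ∧ α ≫ β = g
    · obtain ⟨c, α₀, β₀, fac, hc⟩ := exists_connected_factorization g
      have hck : degree c < k := by
        obtain ⟨j, α, β, hj, fac'⟩ := hg
        obtain ⟨l, s, t, γ, -, -, -, h₁, h₂⟩ := hc j α β fac'
        omega
      subst fac
      refine ⟨Y.map α₀ ≫ u' hck β₀, ?_, ?_, fun i hi h => ?_, fun j hj α β fac' => ?_⟩
      · rw [← f.naturality_assoc, hua, ha']
      · rw [Category.assoc, hub, hb']
      · rw [← Y.map_comp_assoc, hu' hi hck, Category.assoc]
      · obtain ⟨l, s, t, γ, h₁, rfl, rfl, h₂, h₃⟩ := hc j α β fac'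
        have hl : degree l < k := by omega
        rw [← hu' hj hl, ← hu' hck hl, ← Y.map_comp_assoc, ← Y.map_comp_assoc, h₁]
    · have := H k hk
      obtain ⟨φ, h₁, h₂, h₃⟩ := exists_lift_of_relativeLatchingMap f k p (a' hk g) (b' hk g)
        (fun i hi h => u' hi (h ≫ g)) (fun i j hi hj h β => by
          rw [hu' hi hj, Category.assoc]) (hab _ _) (fun i hi β => by
          rw [hua, ha']) (fun i hi β => by rw [hub, hb'])
      exact ⟨φ, h₁, h₂, h₃, fun j hj α β fac => (hg ⟨j, α, β, hj, fac⟩).elim⟩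
  obtain ⟨φ, h₁, h₂, h₃, h₄⟩ := key
  refine ⟨φ, h₁, h₂, ?_, ?_⟩
  · rintro ⟨⟨i, ⟨⟨⟩⟩, β⟩, hi⟩ hi' h
    have hw : h.hom.left ≫ g = β := Over.w h.hom
    exact (h₃ i hi' h.hom.left).trans ((congr_arg (u' hi') hw).trans (Category.comp_id _).symm)
  · rintro ⟨⟨j, ⟨⟨⟩⟩, β⟩, hj⟩ hj' h
    exact (Category.comp_id _).trans
      (h₄ j hj' h.hom.left β (Over.w h.hom))

end

section

variable [HasFiniteLimits C] {X Y : SimplicialObject C} (f : X ⟶ Y) (n : ℕ)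

lemma factorsThroughLowerDegree_matchingCategory :
    FactorsThroughLowerDegree (fun g : MatchingCategory n => degree g.obj.right) := by
  rintro ⟨⟨⟨⟨⟩⟩, a, α⟩, ha⟩ ⟨⟨⟨⟨⟩⟩, b, β⟩, hb⟩ h hab
  have hw := Under.w h.hom
  obtain ⟨h', hh'⟩ | ⟨c, s, t, hc, fac⟩ := eqToHom_or_exists_factorization h.hom.right hab
  · change a = b at h'
    subst h'
    rw [hh'] at hw
    obtain rfl : α = β := by simpa using hw
    refine Or.inl ⟨rfl, ?_⟩
    apply InducedCategory.hom_ext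
    apply Under.UnderMorphism.ext
    exact hh'
  · refine Or.inr ⟨⟨Under.mk (α ≫ s), hc.trans ha⟩, ⟨Under.homMk s rfl⟩, ⟨Under.homMk t ?_⟩, hc, ?_⟩
    · dsimp at fac hw ⊢
      rw [← hw, ← fac, Category.assoc]
    · apply InducedCategory.hom_ext
      apply Under.UnderMorphism.ext
      exact fac

/-- Dual to the latching case: constant diagrams are left adjoint to limits, and factorizations of
`g : [n] ⟶ [k]` now constrain the maps into `g`. -/
theorem hasLiftingProperty_matchingObjMap {A B : C} (p : A ⟶ B)
    (H : ∀ m < n, HasLiftingProperty p (relativeMatchingMap m f)) :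
    HasLiftingProperty p (matchingObjMap n f) := by
  refine (constLimAdj.hasLiftingProperty_iff p (Functor.whiskerLeft (matchingForget n) f)).1 ?_
  refine hasLiftingProperty_of_extendsLifts (factorsThroughLowerDegree_matchingCategory n) _ _ ?_
  rintro ⟨⟨⟨⟨⟩⟩, ⟨⟨k⟩⟩, g⟩, hk⟩ a b sq u
  change op ⦋n⦌ ⟶ op ⦋k⦌ at g
  change k < n at hk
  let a' {i : SimplexCategoryᵒᵖ} (hi : degree i < n) (α : op ⦋n⦌ ⟶ i) : A ⟶ X.obj i :=
    a.app ⟨Under.mk α, hi⟩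
  let b' {i : SimplexCategoryᵒᵖ} (hi : degree i < n) (α : op ⦋n⦌ ⟶ i) : B ⟶ Y.obj i :=
    b.app ⟨Under.mk α, hi⟩
  let u' {i : SimplexCategoryᵒᵖ} (hi : degree i < k) (α : op ⦋n⦌ ⟶ i) : B ⟶ X.obj i :=
    u.app ⟨Under.mk α, hi.trans hk⟩ hi
  have ha' {i j : SimplexCategoryᵒᵖ} (hi : degree i < n) (hj : degree j < n) (h : i ⟶ j)
      (α : op ⦋n⦌ ⟶ i) : a' hi α ≫ X.map h = a' hj (α ≫ h) :=
    (a.naturality (X := ⟨Under.mk α, hi⟩) (Y := ⟨Under.mk (α ≫ h), hj⟩)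
      ⟨Under.homMk h⟩).symm.trans (Category.id_comp _)
  have hb' {i j : SimplexCategoryᵒᵖ} (hi : degree i < n) (hj : degree j < n) (h : i ⟶ j)
      (α : op ⦋n⦌ ⟶ i) : b' hi α ≫ Y.map h = b' hj (α ≫ h) :=
    (b.naturality (X := ⟨Under.mk α, hi⟩) (Y := ⟨Under.mk (α ≫ h), hj⟩)
      ⟨Under.homMk h⟩).symm.trans (Category.id_comp _)
  have hu' {i j : SimplexCategoryᵒᵖ} (hi : degree i < k) (hj : degree j < k) (h : i ⟶ j)
      (α : op ⦋n⦌ ⟶ i) : u' hi α ≫ X.map h = u' hj (α ≫ h) :=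
    (u.naturality ⟨Under.mk α, hi.trans hk⟩ ⟨Under.mk (α ≫ h), hj.trans hk⟩ hi hj
      ⟨Under.homMk h⟩).symm.trans (Category.id_comp _)
  have hab {i : SimplexCategoryᵒᵖ} (hi : degree i < n) (α : op ⦋n⦌ ⟶ i) :
      a' hi α ≫ f.app i = p ≫ b' hi α := congr_app sq.w ⟨Under.mk α, hi⟩
  have hua {i : SimplexCategoryᵒᵖ} (hi : degree i < k) (α : op ⦋n⦌ ⟶ i) :
      p ≫ u' hi α = a' (hi.trans hk) α := u.fac_left ⟨Under.mk α, hi.trans hk⟩ hi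
  have hub {i : SimplexCategoryᵒᵖ} (hi : degree i < k) (α : op ⦋n⦌ ⟶ i) :
      u' hi α ≫ f.app i = b' (hi.trans hk) α := u.fac_right ⟨Under.mk α, hi.trans hk⟩ hi
  have key : ∃ φ : B ⟶ X.obj (op ⦋k⦌), p ≫ φ = a' hk g ∧ φ ≫ f.app _ = b' hk g ∧
      (∀ (i : SimplexCategoryᵒᵖ) (hi : degree i < k) (h : op ⦋k⦌ ⟶ i),
        φ ≫ X.map h = u' hi (g ≫ h)) ∧
      (∀ (j : SimplexCategoryᵒᵖ) (hj : degree j < k) (α : op ⦋n⦌ ⟶ j) (β : j ⟶ op ⦋k⦌),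
        α ≫ β = g → φ = u' hj α ≫ X.map β) := by
    by_cases hg : ∃ (j : SimplexCategoryᵒᵖ) (α : op ⦋n⦌ ⟶ j) (β : j ⟶ op ⦋k⦌),
      degree j < k ∧ α ≫ β = g
    · obtain ⟨c, α₀, β₀, fac, hc⟩ := exists_connected_factorization g
      have hck : degree c < k := by
        obtain ⟨j, α, β, hj, fac'⟩ := hg
        obtain ⟨l, s, t, γ, -, -, -, h₁, h₂⟩ := hc j α β fac'
        omega
      subst fac
      refine ⟨u' hck α₀ ≫ X.map β₀, ?_, ?_, fun i hi h => ?_, fun j hj α β fac' => ?_⟩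
      · rw [← Category.assoc, hua, ha']
      · rw [Category.assoc, f.naturality, ← Category.assoc, hub, hb']
      · rw [Category.assoc, ← X.map_comp, hu' hck hi, Category.assoc]
      · obtain ⟨l, s, t, γ, h₁, rfl, rfl, h₂, h₃⟩ := hc j α β fac'
        have hl : degree l < k := by omega
        rw [X.map_comp, X.map_comp, ← Category.assoc, ← Category.assoc, hu' hj hl,
          hu' hck hl, h₁]
    · have := H k hk
      obtain ⟨φ, h₁, h₂, h₃⟩ := exists_lift_of_relativeMatchingMap f k p (a' hk g) (b' hk g)
        (fun i hi h => u' hi (g ≫ h)) (fun i j hi hj h β => by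
          rw [hu' hi hj, Category.assoc]) (hab _ _) (fun i hi β => by
          rw [hua, ha']) (fun i hi β => by rw [hub, hb'])
      exact ⟨φ, h₁, h₂, h₃, fun j hj α β fac => (hg ⟨j, α, β, hj, fac⟩).elim⟩
  obtain ⟨φ, h₁, h₂, h₃, h₄⟩ := key
  refine ⟨φ, h₁, h₂, ?_, ?_⟩
  · rintro ⟨⟨⟨⟨⟩⟩, j, α⟩, hj⟩ hj' h
    exact (Category.id_comp _).trans
      (h₄ j hj' α h.hom.right (Under.w h.hom))
  · rintro ⟨⟨⟨⟨⟩⟩, i, α⟩, hi⟩ hi' h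
    have hw : g ≫ h.hom.right = α := Under.w h.hom
    exact (h₃ i hi' h.hom.right).trans ((congr_arg (u' hi') hw).trans (Category.id_comp _).symm)

end

end

end CanonicalModel

/-! ### Construction of Reedy factorizations, one degree at a time. -/

namespace CanonicalModel

noncomputable section

variable {C : Type u} [Category.{v} C] [HasFiniteColimits C]

lemma le_degree_of_fac {n : ℕ} {c : SimplexCategoryᵒᵖ} {α : op ⦋n⦌ ⟶ c} {β : c ⟶ op ⦋n⦌}
    (fac : α ≫ β = 𝟙 _) : n ≤ degree c := by
  have : IsSplitMono β.unop := ⟨⟨α.unop, by rw [← unop_comp, fac, unop_id]⟩⟩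
  exact SimplexCategory.len_le_of_mono β.unop

/-! ### Modification of a simplicial object in one degree -/

/-- A factorization `Lₙ Z ⟶ W ⟶ Zₙ` of the latching map of a simplicial object `Z`. -/
structure LatchingFactorization (n : ℕ) (Z : SimplicialObject C) where
  /-- the intermediate object -/
  obj : C
  /-- the first map of the factorization -/
  s : latchingObj n Z ⟶ obj
  /-- the second map of the factorization -/
  q : obj ⟶ Z.obj (op ⦋n⦌)
  fac : s ≫ q = latchingMap n Z

namespace LatchingFactorization

variable {n : ℕ} {Z : SimplicialObject C} (D : LatchingFactorization n Z)

/-- The map `Zᵢ ⟶ W` that is attached to `[i] ⟶ [n]` in `Δᵒᵖ` with `i < n`. -/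
def degenerate {i : SimplexCategoryᵒᵖ} (hi : degree i < n) (β : i ⟶ op ⦋n⦌) : Z.obj i ⟶ D.obj :=
  latchingι n Z hi β ≫ D.s

lemma map_degenerate {i j : SimplexCategoryᵒᵖ} (hi : degree i < n) (hj : degree j < n) (h : i ⟶ j)
    (β : j ⟶ op ⦋n⦌) : Z.map h ≫ D.degenerate hj β = D.degenerate hi (h ≫ β) :=
  map_latchingι_assoc _ _ _ _ _

lemma degenerate_q {i : SimplexCategoryᵒᵖ} (hi : degree i < n) (β : i ⟶ op ⦋n⦌) :
    D.degenerate hi β ≫ D.q = Z.map β := by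
  rw [degenerate, Category.assoc, D.fac, latchingι_latchingMap]

/-- These are the components of the inverse from `W` to degree `n` of the modification. Every
endomorphism of `[n]` other than the identity passes through lower degree, where its lift is
prescribed; linked factorizations prescribe the same lift. -/
lemma exists_comp_section : ∃ (w : (op ⦋n⦌ ⟶ op ⦋n⦌) → (D.obj ⟶ D.obj)), w (𝟙 _) = 𝟙 _ ∧
    (∀ σ, w σ ≫ D.q = D.q ≫ Z.map σ) ∧
    ∀ (i : SimplexCategoryᵒᵖ) (hi : degree i < n) (τ : op ⦋n⦌ ⟶ i) (h : i ⟶ op ⦋n⦌),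
      w (τ ≫ h) = D.q ≫ Z.map τ ≫ D.degenerate hi h := by
  have (σ : op ⦋n⦌ ⟶ op ⦋n⦌) : ∃ (w : D.obj ⟶ D.obj), (σ = 𝟙 _ → w = 𝟙 _) ∧
      w ≫ D.q = D.q ≫ Z.map σ ∧
      ∀ (i : SimplexCategoryᵒᵖ) (hi : degree i < n) (τ : op ⦋n⦌ ⟶ i) (h : i ⟶ op ⦋n⦌),
        τ ≫ h = σ → w = D.q ≫ Z.map τ ≫ D.degenerate hi h := by
    obtain ⟨c, α₀, β₀, fac₀, hc⟩ := exists_connected_factorization σ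
    by_cases hcn : degree c < n
    · refine ⟨D.q ≫ Z.map α₀ ≫ D.degenerate hcn β₀, fun hσ => ?_, ?_, fun i hi τ h fac => ?_⟩
      · exact (hcn.not_ge (le_degree_of_fac (fac₀.trans hσ))).elim
      · rw [Category.assoc, Category.assoc, degenerate_q, ← Z.map_comp, fac₀]
      · obtain ⟨k, s, t, γ, h₁, rfl, rfl, h₂, h₃⟩ := hc i τ h fac
        have hk : degree k < n := by omega
        rw [← D.map_degenerate hcn hk, ← D.map_degenerate hi hk, ← Z.map_comp_assoc,
          ← Z.map_comp_assoc, h₁]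
    -- The epi-mono factorization has the smallest degree among all factorizations, so none goes
    -- below `n`.
    · have hσ : ∀ (i : SimplexCategoryᵒᵖ) (τ : op ⦋n⦌ ⟶ i) (h : i ⟶ op ⦋n⦌),
          degree i < n → τ ≫ h ≠ σ := fun i τ h hi fac => by
        obtain ⟨k, s, t, γ, -, -, -, h₂, h₃⟩ := hc i τ h fac
        omega
      obtain ⟨h₀, hσ'⟩ | ⟨i, τ, h, hi, fac⟩ := eqToHom_or_exists_factorization σ rfl
      · exact ⟨𝟙 _, fun _ => rfl, by simp [hσ'], fun i hi τ h fac => (hσ i τ h hi fac).elim⟩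
      · exact (hσ i τ h hi fac).elim
  choose w hw₁ hw₂ hw₃ using this
  exact ⟨w, hw₁ _ rfl, hw₂, fun i hi τ h => hw₃ _ i hi τ h rfl⟩

variable [HasFiniteLimits C]

/-- The index set for the conditions on degenerate components in `LatchingFactorization.level`. -/
abbrev DegenerateIndex (n : ℕ) (a : SimplexCategoryᵒᵖ) : Type :=
  Σ i : Fin n, (a ⟶ op ⦋i.1⦌) × ((op ⦋i.1⦌ : SimplexCategoryᵒᵖ) ⟶ op ⦋n⦌)

/-- The first of the two maps whose equalizer is `LatchingFactorization.level`. -/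
def levelFst (a : SimplexCategoryᵒᵖ) :
    (Z.obj a ⨯ ∏ᶜ fun _ : a ⟶ op ⦋n⦌ => D.obj) ⟶
      (∏ᶜ fun _ : a ⟶ op ⦋n⦌ => Z.obj (op ⦋n⦌)) ⨯ ∏ᶜ fun _ : DegenerateIndex n a => D.obj :=
  prod.lift (Pi.lift fun σ => prod.snd ≫ Pi.π _ σ ≫ D.q)
    (Pi.lift fun t => prod.snd ≫ Pi.π _ (t.2.1 ≫ t.2.2))

/-- The second of the two maps whose equalizer is `LatchingFactorization.level`. -/
def levelSnd (a : SimplexCategoryᵒᵖ) :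
    (Z.obj a ⨯ ∏ᶜ fun _ : a ⟶ op ⦋n⦌ => D.obj) ⟶
      (∏ᶜ fun _ : a ⟶ op ⦋n⦌ => Z.obj (op ⦋n⦌)) ⨯ ∏ᶜ fun _ : DegenerateIndex n a => D.obj :=
  prod.lift (Pi.lift fun σ => prod.fst ≫ Z.map σ)
    (Pi.lift fun t => prod.fst ≫ Z.map t.2.1 ≫ D.degenerate t.1.2 t.2.2)

/-- The level `a` of the modification of `Z`: it classifies the generalized elements `z` of `Zₐ`
with lifts to `W` of the elements `σ z` for `σ : a ⟶ [n]`, which are prescribed if `σ` factors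
through lower degrees. -/
abbrev level (a : SimplexCategoryᵒᵖ) : C := equalizer (D.levelFst a) (D.levelSnd a)

/-- The projection from the modification of `Z` to `Z`. -/
def proj (a : SimplexCategoryᵒᵖ) : D.level a ⟶ Z.obj a := equalizer.ι _ _ ≫ prod.fst

/-- The lift to `W` that is indexed by `σ : a ⟶ [n]`. -/
def comp {a : SimplexCategoryᵒᵖ} (σ : a ⟶ op ⦋n⦌) : D.level a ⟶ D.obj :=
  equalizer.ι _ _ ≫ prod.snd ≫ Pi.π _ σ

lemma levelFst_fst {a : SimplexCategoryᵒᵖ} (σ : a ⟶ op ⦋n⦌) :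
    D.levelFst a ≫ prod.fst ≫ Pi.π _ σ = prod.snd ≫ Pi.π _ σ ≫ D.q := by
  simp [levelFst, prod.lift_fst_assoc]

lemma levelFst_snd {a : SimplexCategoryᵒᵖ} (t : DegenerateIndex n a) :
    D.levelFst a ≫ prod.snd ≫ Pi.π _ t = prod.snd ≫ Pi.π _ (t.2.1 ≫ t.2.2) := by
  simp [levelFst, prod.lift_snd_assoc]

lemma levelSnd_fst {a : SimplexCategoryᵒᵖ} (σ : a ⟶ op ⦋n⦌) :
    D.levelSnd a ≫ prod.fst ≫ Pi.π _ σ = prod.fst ≫ Z.map σ := by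
  simp [levelSnd, prod.lift_fst_assoc]

lemma levelSnd_snd {a : SimplexCategoryᵒᵖ} (t : DegenerateIndex n a) :
    D.levelSnd a ≫ prod.snd ≫ Pi.π _ t =
      prod.fst ≫ Z.map t.2.1 ≫ D.degenerate t.1.2 t.2.2 := by
  simp [levelSnd, prod.lift_snd_assoc]

lemma comp_q {a : SimplexCategoryᵒᵖ} (σ : a ⟶ op ⦋n⦌) :
    D.comp σ ≫ D.q = D.proj a ≫ Z.map σ := by
  simp only [comp, proj, Category.assoc]
  rw [← levelFst_fst, ← levelSnd_fst, equalizer.condition_assoc]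

lemma comp_eq {a i : SimplexCategoryᵒᵖ} (hi : degree i < n) (τ : a ⟶ i) (h : i ⟶ op ⦋n⦌) :
    D.comp (τ ≫ h) = D.proj a ≫ Z.map τ ≫ D.degenerate hi h := by
  simp only [comp, proj, Category.assoc]
  have h₁ := D.levelFst_snd ⟨⟨degree i, hi⟩, τ, h⟩
  have h₂ := D.levelSnd_snd ⟨⟨degree i, hi⟩, τ, h⟩
  dsimp only at h₁ h₂
  exact (congr_arg (_ ≫ ·) h₁).symm.trans
    ((equalizer.condition_assoc _ _ _).trans (congr_arg (_ ≫ ·) h₂))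

lemma level_hom_ext {a : SimplexCategoryᵒᵖ} {A : C} {x y : A ⟶ D.level a}
    (h₁ : x ≫ D.proj a = y ≫ D.proj a)
    (h₂ : ∀ σ : a ⟶ op ⦋n⦌, x ≫ D.comp σ = y ≫ D.comp σ) : x = y := by
  refine equalizer.hom_ext (Limits.prod.hom_ext ?_ (Pi.hom_ext _ _ fun σ => ?_))
  · simpa [proj, Category.assoc] using h₁
  · simpa [comp, Category.assoc] using h₂ σ

lemma exists_level_lift {a : SimplexCategoryᵒᵖ} {A : C} (z : A ⟶ Z.obj a)
    (w : (a ⟶ op ⦋n⦌) → (A ⟶ D.obj)) (hw : ∀ σ, w σ ≫ D.q = z ≫ Z.map σ)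
    (hw' : ∀ (i : SimplexCategoryᵒᵖ) (hi : degree i < n) (τ : a ⟶ i) (h : i ⟶ op ⦋n⦌),
      w (τ ≫ h) = z ≫ Z.map τ ≫ D.degenerate hi h) :
    ∃ x : A ⟶ D.level a, x ≫ D.proj a = z ∧ ∀ σ, x ≫ D.comp σ = w σ := by
  refine ⟨equalizer.lift (prod.lift z (Pi.lift w)) ?_, ?_, fun σ => ?_⟩
  · apply Limits.prod.hom_ext
    · refine Pi.hom_ext _ _ fun σ => ?_
      simp [levelFst, levelSnd, prod.lift_fst_assoc, prod.lift_snd_assoc, hw]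
    · refine Pi.hom_ext _ _ fun t => ?_
      simp [levelFst, levelSnd, prod.lift_fst_assoc, prod.lift_snd_assoc,
        hw' (op ⦋t.1.1⦌) t.1.2]
  · simp [proj, prod.lift_fst]
  · simp [comp, prod.lift_snd_assoc]

lemma exists_level_map {a b : SimplexCategoryᵒᵖ} (θ : a ⟶ b) :
    ∃ x : D.level a ⟶ D.level b, x ≫ D.proj b = D.proj a ≫ Z.map θ ∧
      ∀ σ, x ≫ D.comp σ = D.comp (θ ≫ σ) :=
  D.exists_level_lift _ _ (fun σ => by rw [comp_q, Z.map_comp, Category.assoc])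
    (fun i hi τ h => by rw [← Category.assoc θ, D.comp_eq hi, Z.map_comp]; simp)

/-- The modification of a simplicial object `Z` that has the intermediate object of a factorization
of the latching map `Lₙ Z ⟶ Zₙ` in degree `n`, and is unchanged in degrees `< n`. -/
def modification : SimplicialObject C where
  obj := D.level
  map θ := (D.exists_level_map θ).choose
  map_id a := D.level_hom_ext (by rw [(D.exists_level_map _).choose_spec.1]; simp)
    fun σ => by rw [(D.exists_level_map _).choose_spec.2]; simp
  map_comp {a b c} θ θ' := D.level_hom_ext (by
      rw [(D.exists_level_map _).choose_spec.1, Category.assoc,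
        (D.exists_level_map _).choose_spec.1, ← Category.assoc,
        (D.exists_level_map _).choose_spec.1]
      simp)
    fun σ => by
      rw [(D.exists_level_map _).choose_spec.2, Category.assoc, Category.assoc,
        (D.exists_level_map _).choose_spec.2, (D.exists_level_map _).choose_spec.2]

/-- The projection from the modification of `Z` to `Z`. -/
def modificationProj : D.modification ⟶ Z where
  app := D.proj
  naturality _ _ θ := (D.exists_level_map θ).choose_spec.1

/-- The projection from level `a` of the modification of `Z` that is indexed by `σ : a ⟶ [n]`. -/
def modificationComp {a : SimplexCategoryᵒᵖ} (σ : a ⟶ op ⦋n⦌) : D.modification.obj a ⟶ D.obj :=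
  D.comp σ

lemma modificationComp_q {a : SimplexCategoryᵒᵖ} (σ : a ⟶ op ⦋n⦌) :
    D.modificationComp σ ≫ D.q = D.modificationProj.app a ≫ Z.map σ :=
  D.comp_q σ

lemma modificationComp_comp {a i : SimplexCategoryᵒᵖ} (hi : degree i < n) (τ : a ⟶ i)
    (h : i ⟶ op ⦋n⦌) :
    D.modificationComp (τ ≫ h) = D.modificationProj.app a ≫ Z.map τ ≫ D.degenerate hi h :=
  D.comp_eq hi τ h

lemma map_modificationComp {a b : SimplexCategoryᵒᵖ} (θ : a ⟶ b) (σ : b ⟶ op ⦋n⦌) :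
    D.modification.map θ ≫ D.modificationComp σ = D.modificationComp (θ ≫ σ) :=
  (D.exists_level_map θ).choose_spec.2 σ

lemma modification_hom_ext {a : SimplexCategoryᵒᵖ} {A : C} {x y : A ⟶ D.modification.obj a}
    (h₁ : x ≫ D.modificationProj.app a = y ≫ D.modificationProj.app a)
    (h₂ : ∀ σ : a ⟶ op ⦋n⦌, x ≫ D.modificationComp σ = y ≫ D.modificationComp σ) : x = y :=
  D.level_hom_ext h₁ h₂

lemma exists_modification_obj_lift {a : SimplexCategoryᵒᵖ} {A : C} (z : A ⟶ Z.obj a)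
    (w : (a ⟶ op ⦋n⦌) → (A ⟶ D.obj)) (hw : ∀ σ, w σ ≫ D.q = z ≫ Z.map σ)
    (hw' : ∀ (i : SimplexCategoryᵒᵖ) (hi : degree i < n) (τ : a ⟶ i) (h : i ⟶ op ⦋n⦌),
      w (τ ≫ h) = z ≫ Z.map τ ≫ D.degenerate hi h) :
    ∃ x : A ⟶ D.modification.obj a, x ≫ D.modificationProj.app a = z ∧
      ∀ σ, x ≫ D.modificationComp σ = w σ :=
  D.exists_level_lift z w hw hw'

/-- Every `σ : a ⟶ [n]` starts in degree `< n`, so all the lifts are prescribed and add no data. -/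
lemma isIso_modificationProj_app {a : SimplexCategoryᵒᵖ} (ha : degree a < n) :
    IsIso (D.modificationProj.app a) := by
  obtain ⟨x, hx₁, hx₂⟩ := D.exists_modification_obj_lift (𝟙 (Z.obj a))
    (fun σ => D.degenerate ha σ) (fun σ => by rw [degenerate_q, Category.id_comp])
    (fun i hi τ h => by rw [Category.id_comp, map_degenerate])
  refine ⟨x, D.modification_hom_ext ?_ fun σ => ?_, hx₁⟩
  · rw [Category.assoc, hx₁]
    simp
  · rw [Category.assoc, hx₂, Category.id_comp]
    have := D.modificationComp_comp ha (𝟙 a) σ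
    simp only [Category.id_comp, Z.map_id] at this
    exact this.symm

lemma isIso_modificationComp_id : IsIso (D.modificationComp (𝟙 (op ⦋n⦌))) := by
  obtain ⟨w, hw₁, hw₂, hw₃⟩ := D.exists_comp_section
  obtain ⟨x, hx₁, hx₂⟩ := D.exists_modification_obj_lift D.q w hw₂ hw₃
  refine ⟨x, D.modification_hom_ext ?_ fun σ => ?_, by rw [hx₂, hw₁]⟩
  · rw [Category.assoc, hx₁, modificationComp_q]
    simp
  · rw [Category.assoc, hx₂, Category.id_comp]
    obtain ⟨-, rfl⟩ | ⟨i, τ, h, hi, rfl⟩ := eqToHom_or_exists_factorization σ rfl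
    · simp [hw₁]
    · rw [hw₃ i hi, D.modificationComp_comp hi, ← Category.assoc, modificationComp_q]
      simp

/-- The component at `σ` can only be `X.map σ ≫ x`; agreement with `s` on the latching object is
exactly what the prescribed lifts require. -/
lemma exists_modification_lift {X : SimplicialObject C} (f : X ⟶ Z) (x : X.obj (op ⦋n⦌) ⟶ D.obj)
    (hx : x ≫ D.q = f.app _)
    (hx' : latchingMap n X ≫ x = latchingObjMap n f ≫ D.s) :
    ∃ f' : X ⟶ D.modification, f' ≫ D.modificationProj = f ∧
      f'.app _ ≫ D.modificationComp (𝟙 (op ⦋n⦌)) = x := by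
  have hx'' (i : SimplexCategoryᵒᵖ) (hi : degree i < n) (h : i ⟶ op ⦋n⦌) :
      X.map h ≫ x = f.app i ≫ D.degenerate hi h := by
    rw [← latchingι_latchingMap_assoc hi, hx', latchingι_latchingObjMap_assoc, degenerate]
  have (a : SimplexCategoryᵒᵖ) : ∃ y : X.obj a ⟶ D.modification.obj a,
      y ≫ D.modificationProj.app a = f.app a ∧ ∀ σ, y ≫ D.modificationComp σ = X.map σ ≫ x :=
    D.exists_modification_obj_lift (f.app a) (fun σ => X.map σ ≫ x)
      (fun σ => by rw [Category.assoc, hx, f.naturality])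
      (fun i hi τ h => by rw [X.map_comp, Category.assoc, hx'' i hi, f.naturality_assoc])
  choose y hy₁ hy₂ using this
  refine ⟨{ app := y, naturality := fun a b θ => D.modification_hom_ext ?_ fun σ => ?_ }, ?_, ?_⟩
  · rw [Category.assoc, hy₁, Category.assoc, D.modificationProj.naturality, ← Category.assoc,
      hy₁, f.naturality]
  · rw [Category.assoc, hy₂, Category.assoc, map_modificationComp, hy₂, X.map_comp,
      Category.assoc]
  · ext a
    exact hy₁ a
  · exact (hy₂ _ _).trans (by simp)

/-- Once degree `n` of the modification is identified with `W`, its latching map becomes `s`; this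
is how the chosen factorization reappears in relative latching maps. -/
lemma latchingObjMap_modificationProj_comp :
    latchingMap n D.modification ≫ D.modificationComp (𝟙 (op ⦋n⦌)) =
      latchingObjMap n D.modificationProj ≫ D.s :=
  latchingObj_hom_ext fun i hi β => by
    rw [latchingι_latchingMap_assoc, latchingι_latchingObjMap_assoc, map_modificationComp]
    have := D.modificationComp_comp hi (𝟙 i) (β ≫ 𝟙 _)
    simpa [degenerate] using this

end LatchingFactorization

end

end CanonicalModel

namespace CanonicalModel

noncomputable section

variable {C : Type u} [Category.{v} C]

/-! ### Functoriality of latching and matching objects -/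

section

variable [HasFiniteColimits C] {X Y Z : SimplicialObject C} (n : ℕ)

lemma latchingObjMap_comp (f : X ⟶ Y) (g : Y ⟶ Z) :
    latchingObjMap n (f ≫ g) = latchingObjMap n f ≫ latchingObjMap n g :=
  latchingObj_hom_ext fun i hi β => by simp

lemma isIso_latchingObjMap (f : X ⟶ Y) (hf : ∀ a, degree a < n → IsIso (f.app a)) :
    IsIso (latchingObjMap n f) := by
  have (j : LatchingCategory n) : IsIso ((Functor.whiskerLeft (latchingForget n) f).app j) :=
    hf _ j.property
  have : IsIso (Functor.whiskerLeft (latchingForget n) f) := NatIso.isIso_of_isIso_app _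
  exact inferInstanceAs (IsIso (colim.map (Functor.whiskerLeft (latchingForget n) f)))

/-- The map between the sources of the relative latching maps of `f` and `f ≫ t`. -/
def relativeLatchingSourceMap {f : X ⟶ Y} {t : Y ⟶ Z} {g : X ⟶ Z} (fac : f ≫ t = g) :
    pushout (latchingMap n X) (latchingObjMap n f) ⟶
      pushout (latchingMap n X) (latchingObjMap n g) :=
  pushout.map _ _ _ _ (𝟙 _) (latchingObjMap n t) (𝟙 _) (by simp)
    (by simp [← fac, latchingObjMap_comp])

lemma isIso_relativeLatchingSourceMap {f : X ⟶ Y} {t : Y ⟶ Z} {g : X ⟶ Z} (fac : f ≫ t = g)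
    (ht : ∀ a, degree a < n → IsIso (t.app a)) : IsIso (relativeLatchingSourceMap n fac) := by
  have := isIso_latchingObjMap n t ht
  unfold relativeLatchingSourceMap
  infer_instance

lemma inl_relativeLatchingSourceMap_assoc {f : X ⟶ Y} {t : Y ⟶ Z} {g : X ⟶ Z} (fac : f ≫ t = g)
    {A : C} (a : pushout (latchingMap n X) (latchingObjMap n g) ⟶ A) :
    pushout.inl _ _ ≫ relativeLatchingSourceMap n fac ≫ a = pushout.inl _ _ ≫ a := by
  simp [relativeLatchingSourceMap, pushout.inl_desc_assoc, pushout.map]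

lemma inr_relativeLatchingSourceMap_assoc {f : X ⟶ Y} {t : Y ⟶ Z} {g : X ⟶ Z} (fac : f ≫ t = g)
    {A : C} (a : pushout (latchingMap n X) (latchingObjMap n g) ⟶ A) :
    pushout.inr _ _ ≫ relativeLatchingSourceMap n fac ≫ a =
      latchingObjMap n t ≫ pushout.inr _ _ ≫ a := by
  simp [relativeLatchingSourceMap, pushout.inr_desc_assoc, pushout.map]

lemma relativeLatchingSourceMap_comp {f : X ⟶ Y} {t : Y ⟶ Z} {g : X ⟶ Z} (fac : f ≫ t = g) :
    relativeLatchingSourceMap n fac ≫ relativeLatchingMap n g =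
      relativeLatchingMap n f ≫ t.app _ := by
  apply pushout.hom_ext
  · simp [inl_relativeLatchingSourceMap_assoc, ← fac]
  · simp [inr_relativeLatchingSourceMap_assoc, latchingMap_naturality]

/-- The relative latching map only depends on the target up to isomorphism in degrees `≤ n`. -/
def relativeLatchingMapIso {f : X ⟶ Y} {t : Y ⟶ Z} {g : X ⟶ Z} (fac : f ≫ t = g)
    (ht : ∀ a, degree a ≤ n → IsIso (t.app a)) :
    Arrow.mk (relativeLatchingMap n f) ≅ Arrow.mk (relativeLatchingMap n g) :=
  have := isIso_relativeLatchingSourceMap n fac (fun a ha => ht a ha.le)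
  have := ht (op ⦋n⦌) le_rfl
  Arrow.isoMk (asIso (relativeLatchingSourceMap n fac)) (asIso (t.app _))
    (relativeLatchingSourceMap_comp n fac)

end

section

variable [HasFiniteLimits C] {X Y Z : SimplicialObject C} (n : ℕ)

lemma matchingObjMap_id : matchingObjMap n (𝟙 X) = 𝟙 _ :=
  matchingObj_hom_ext fun i hi β => by simp

lemma matchingObjMap_comp (f : X ⟶ Y) (g : Y ⟶ Z) :
    matchingObjMap n (f ≫ g) = matchingObjMap n f ≫ matchingObjMap n g :=
  matchingObj_hom_ext fun i hi β => by
    rw [Category.assoc, matchingObjMap_matchingπ, matchingObjMap_matchingπ, ← Category.assoc,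
      matchingObjMap_matchingπ, NatTrans.comp_app, Category.assoc]

lemma isIso_matchingObjMap (f : X ⟶ Y) (hf : ∀ a, degree a < n → IsIso (f.app a)) :
    IsIso (matchingObjMap n f) := by
  have (j : MatchingCategory n) : IsIso ((Functor.whiskerLeft (matchingForget n) f).app j) :=
    hf _ j.property
  have : IsIso (Functor.whiskerLeft (matchingForget n) f) := NatIso.isIso_of_isIso_app _
  exact inferInstanceAs (IsIso (lim.map (Functor.whiskerLeft (matchingForget n) f)))

/-- The map between the targets of the relative matching maps that is induced by a square. -/
def relativeMatchingTargetMap {X' Y' : SimplicialObject C} {f : X ⟶ Y} {g : X' ⟶ Y'}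
    (a : X ⟶ X') (b : Y ⟶ Y') (w : a ≫ g = f ≫ b) :
    pullback (matchingMap n Y) (matchingObjMap n f) ⟶
      pullback (matchingMap n Y') (matchingObjMap n g) :=
  pullback.map _ _ _ _ (b.app _) (matchingObjMap n a) (matchingObjMap n b)
    (matchingMap_naturality n b).symm (by rw [← matchingObjMap_comp, ← matchingObjMap_comp, w])

@[simp]
lemma relativeMatchingTargetMap_fst {X' Y' : SimplicialObject C} {f : X ⟶ Y} {g : X' ⟶ Y'}
    (a : X ⟶ X') (b : Y ⟶ Y') (w : a ≫ g = f ≫ b) :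
    relativeMatchingTargetMap n a b w ≫ pullback.fst _ _ = pullback.fst _ _ ≫ b.app _ :=
  pullback.lift_fst _ _ _

@[simp]
lemma relativeMatchingTargetMap_snd {X' Y' : SimplicialObject C} {f : X ⟶ Y} {g : X' ⟶ Y'}
    (a : X ⟶ X') (b : Y ⟶ Y') (w : a ≫ g = f ≫ b) :
    relativeMatchingTargetMap n a b w ≫ pullback.snd _ _ =
      pullback.snd _ _ ≫ matchingObjMap n a :=
  pullback.lift_snd _ _ _

lemma relativeMatchingMap_naturality {X' Y' : SimplicialObject C} {f : X ⟶ Y} {g : X' ⟶ Y'}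
    (a : X ⟶ X') (b : Y ⟶ Y') (w : a ≫ g = f ≫ b) :
    a.app _ ≫ relativeMatchingMap n g =
      relativeMatchingMap n f ≫ relativeMatchingTargetMap n a b w := by
  apply pullback.hom_ext
  · have := congr_app w (op ⦋n⦌)
    dsimp at this
    rw [Category.assoc, Category.assoc, relativeMatchingTargetMap_fst, relativeMatchingMap_fst,
      ← Category.assoc, relativeMatchingMap_fst, this]
  · rw [Category.assoc, Category.assoc, relativeMatchingTargetMap_snd, relativeMatchingMap_snd,
      ← Category.assoc, relativeMatchingMap_snd, matchingMap_naturality]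

lemma relativeMatchingTargetMap_comp {X' Y' X'' Y'' : SimplicialObject C} {f : X ⟶ Y}
    {g : X' ⟶ Y'} {h : X'' ⟶ Y''} {a : X ⟶ X'} {b : Y ⟶ Y'} {a' : X' ⟶ X''} {b' : Y' ⟶ Y''}
    (w : a ≫ g = f ≫ b) (w' : a' ≫ h = g ≫ b') (w'' : (a ≫ a') ≫ h = f ≫ b ≫ b') :
    relativeMatchingTargetMap n a b w ≫ relativeMatchingTargetMap n a' b' w' =
      relativeMatchingTargetMap n _ _ w'' := by
  apply pullback.hom_ext
  · rw [Category.assoc, relativeMatchingTargetMap_fst, relativeMatchingTargetMap_fst,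
      ← Category.assoc, relativeMatchingTargetMap_fst, Category.assoc, NatTrans.comp_app]
  · rw [Category.assoc, relativeMatchingTargetMap_snd, relativeMatchingTargetMap_snd,
      ← Category.assoc, relativeMatchingTargetMap_snd, Category.assoc, matchingObjMap_comp]

/-- The relative matching map, as a functor on arrows. -/
@[simps]
def relativeMatchingFunctor : Arrow (SimplicialObject C) ⥤ Arrow C where
  obj f := Arrow.mk (relativeMatchingMap n f.hom)
  map {f g} φ := Arrow.homMk (φ.left.app _) (relativeMatchingTargetMap n φ.left φ.right φ.w)
    (relativeMatchingMap_naturality n _ _ φ.w)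
  map_id f := by
    ext
    · simp
    · apply pullback.hom_ext
      · exact (relativeMatchingTargetMap_fst n _ _ (𝟙 f : f ⟶ f).w).trans (by simp)
      · exact (relativeMatchingTargetMap_snd n _ _ (𝟙 f : f ⟶ f).w).trans (by simp [matchingObjMap_id])
  map_comp φ ψ := by
    ext
    · simp
    · exact (relativeMatchingTargetMap_comp n φ.w ψ.w (φ ≫ ψ).w).symm

lemma isIso_relativeMatchingTargetMap {t : X ⟶ Y} {p : Y ⟶ Z} (w : t ≫ p = (t ≫ p) ≫ 𝟙 Z)
    (ht : ∀ a, degree a < n → IsIso (t.app a)) :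
    IsIso (relativeMatchingTargetMap n t (𝟙 Z) w) := by
  have := isIso_matchingObjMap n t ht
  have : IsIso (matchingObjMap n (𝟙 Z)) := by rw [matchingObjMap_id]; infer_instance
  unfold relativeMatchingTargetMap
  infer_instance

/-- The relative matching map only depends on the source up to isomorphism in degrees `≤ n`. -/
def relativeMatchingMapIso (t : X ⟶ Y) (p : Y ⟶ Z) (ht : ∀ a, degree a ≤ n → IsIso (t.app a)) :
    Arrow.mk (relativeMatchingMap n (t ≫ p)) ≅ Arrow.mk (relativeMatchingMap n p) :=
  have w : t ≫ p = (t ≫ p) ≫ 𝟙 Z := (Category.comp_id _).symm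
  have := isIso_relativeMatchingTargetMap n w (fun a ha => ht a ha.le)
  have := ht (op ⦋n⦌) le_rfl
  Arrow.isoMk (asIso (t.app _)) (asIso (relativeMatchingTargetMap n t (𝟙 Z) w))
    (relativeMatchingMap_naturality n _ _ w)

end

/-! ### The relative latching and matching maps of a modification -/

namespace LatchingFactorization

variable [HasFiniteColimits C] [HasFiniteLimits C] {n : ℕ} {Y Z : SimplicialObject C}
  (D : LatchingFactorization n Z) (p : Z ⟶ Y)

/-- Above degree `n` no new data arise: the point of `Zₘ` is recovered from the relative matching
map of `p`, and the lifts to `W`, indexed by `[m] ⟶ [n]` with `n < m`, are already part of the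
matching object. -/
lemma isIso_relativeMatchingMap_modificationProj {m : ℕ} (hm : n < m)
    [IsIso (relativeMatchingMap m p)] :
    IsIso (relativeMatchingMap m (D.modificationProj ≫ p)) := by
  have w : D.modificationProj ≫ p = (D.modificationProj ≫ p) ≫ 𝟙 Y := (Category.comp_id _).symm
  -- `z` sends a point of `Yₘ` with matching data in the modification to the point of `Zₘ` that it
  -- determines.
  obtain ⟨z, hz⟩ : ∃ z, z ≫ relativeMatchingMap m p =
      relativeMatchingTargetMap m D.modificationProj (𝟙 Y) w :=
    ⟨relativeMatchingTargetMap m D.modificationProj (𝟙 Y) w ≫ inv (relativeMatchingMap m p),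
      by simp⟩
  have hz₁ : z ≫ p.app _ = pullback.fst _ _ := by
    rw [← relativeMatchingMap_fst, ← Category.assoc, hz, relativeMatchingTargetMap_fst]
    simp
  have hz₂ {i : SimplexCategoryᵒᵖ} (hi : degree i < m) (α : op ⦋m⦌ ⟶ i) :
      z ≫ Z.map α = pullback.snd _ _ ≫ matchingπ m _ hi α ≫ D.modificationProj.app i := by
    rw [← matchingMap_matchingπ hi, ← relativeMatchingMap_snd p, Category.assoc,
      ← Category.assoc z, hz, ← Category.assoc, relativeMatchingTargetMap_snd, Category.assoc,
      matchingObjMap_matchingπ]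
  have hz₃ : relativeMatchingMap m (D.modificationProj ≫ p) ≫ z = D.modificationProj.app _ := by
    rw [← cancel_mono (relativeMatchingMap m p), Category.assoc, hz,
      relativeMatchingMap_naturality m _ _ w]
  obtain ⟨x, hx₁, hx₂⟩ := D.exists_modification_obj_lift z
    (fun σ => pullback.snd _ _ ≫ matchingπ m _ (i := op ⦋n⦌) hm σ ≫
      D.modificationComp (𝟙 (op ⦋n⦌))) (fun σ => by
      rw [hz₂ hm, Category.assoc, Category.assoc, modificationComp_q]
      simp) (fun i hi τ h => by
      have := D.modificationComp_comp hi (𝟙 i) h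
      rw [← Category.assoc z, hz₂ (hi.trans hm), ← matchingπ_map (hi.trans hm) hm, Category.assoc,
        map_modificationComp, Category.assoc, Category.assoc]
      congr 2
      simpa using this)
  refine ⟨x, D.modification_hom_ext ?_ fun σ => ?_, pullback.hom_ext ?_
    (matchingObj_hom_ext fun i hi α => D.modification_hom_ext ?_ fun σ => ?_)⟩
  · rw [Category.assoc, hx₁, hz₃, Category.id_comp]
  · rw [Category.assoc, hx₂, ← Category.assoc, relativeMatchingMap_snd, ← Category.assoc,
      matchingMap_matchingπ, map_modificationComp, Category.comp_id, Category.id_comp]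
  · rw [Category.assoc, relativeMatchingMap_fst, NatTrans.comp_app, ← Category.assoc, hx₁, hz₁,
      Category.id_comp]
  · simp only [Category.assoc, Category.id_comp]
    rw [← Category.assoc (relativeMatchingMap m _), relativeMatchingMap_snd,
      ← Category.assoc (matchingMap m _), matchingMap_matchingπ, D.modificationProj.naturality,
      ← Category.assoc, hx₁, hz₂ hi]
  · simp only [Category.assoc, Category.id_comp]
    rw [← Category.assoc (relativeMatchingMap m _), relativeMatchingMap_snd,
      ← Category.assoc (matchingMap m _), matchingMap_matchingπ, map_modificationComp, hx₂,
      ← matchingπ_map hi, Category.assoc, map_modificationComp, Category.comp_id]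

/-- The relative matching map in degree `n` of the modification is the second map of the
factorization. -/
def relativeMatchingMapIso [IsIso (relativeMatchingMap n p)] :
    Arrow.mk (relativeMatchingMap n (D.modificationProj ≫ p)) ≅ Arrow.mk D.q :=
  have w : D.modificationProj ≫ p = (D.modificationProj ≫ p) ≫ 𝟙 Y := (Category.comp_id _).symm
  have := isIso_relativeMatchingTargetMap n w (fun _ ha => D.isIso_modificationProj_app ha)
  have := D.isIso_modificationComp_id
  Arrow.isoMk (asIso (D.modificationComp (𝟙 _)))
    (asIso (relativeMatchingTargetMap n _ _ w ≫ inv (relativeMatchingMap n p))) (by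
      have := relativeMatchingMap_naturality n _ _ w
      dsimp
      rw [← Category.assoc, ← this, modificationComp_q]
      simp)

variable {D}

/-- The relative latching map in degree `n` of a lift to the modification. -/
def relativeLatchingMapIso {X : SimplicialObject C} {f : X ⟶ Z} {f' : X ⟶ D.modification}
    (fac : f' ≫ D.modificationProj = f)
    (l : pushout (latchingMap n X) (latchingObjMap n f) ⟶ D.obj) (hl : pushout.inr _ _ ≫ l = D.s)
    (hf' : f'.app _ ≫ D.modificationComp (𝟙 (op ⦋n⦌)) = pushout.inl _ _ ≫ l) :
    Arrow.mk (relativeLatchingMap n f') ≅ Arrow.mk l :=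
  have := isIso_relativeLatchingSourceMap n fac (fun _ ha => D.isIso_modificationProj_app ha)
  have := D.isIso_modificationComp_id
  Arrow.isoMk (asIso (relativeLatchingSourceMap n fac)) (asIso (D.modificationComp (𝟙 _))) (by
    apply pushout.hom_ext
    · simp [inl_relativeLatchingSourceMap_assoc, hf']
    · simp [inr_relativeLatchingSourceMap_assoc, D.latchingObjMap_modificationProj_comp, hl])

end LatchingFactorization

section

variable [HasFiniteColimits C] [HasFiniteLimits C] {X Y Z : SimplicialObject C}

/-- The inductive step of the construction of Reedy factorizations. -/
lemma exists_factorization_step (L R : MorphismProperty C) [L.RespectsIso] [R.RespectsIso]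
    [L.HasFactorization R] (n : ℕ) (f : X ⟶ Z) (p : Z ⟶ Y)
    (hp : ∀ m, n ≤ m → IsIso (relativeMatchingMap m p)) :
    ∃ (Z' : SimplicialObject C) (f' : X ⟶ Z') (t : Z' ⟶ Z), f' ≫ t = f ∧
      (∀ a, degree a < n → IsIso (t.app a)) ∧
      L (relativeLatchingMap n f') ∧ R (relativeMatchingMap n (t ≫ p)) ∧
      ∀ m, n < m → IsIso (relativeMatchingMap m (t ≫ p)) := by
  -- Factoring the relative latching map of `f` prescribes degree `n`. The first factor becomes the
  -- new relative latching map, and the second the new relative matching map, since that of `p` is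
  -- invertible in degree `n`.
  let h := MorphismProperty.factorizationData L R (relativeLatchingMap n f)
  let D : LatchingFactorization n Z :=
    { obj := h.Z
      s := pushout.inr _ _ ≫ h.i
      q := h.p
      fac := by simp }
  obtain ⟨f', hf₁, hf₂⟩ := D.exists_modification_lift f (pushout.inl _ _ ≫ h.i)
    (by simp [D]) (by simp [D, pushout.condition_assoc])
  refine ⟨D.modification, f', D.modificationProj, hf₁,
    fun a ha => D.isIso_modificationProj_app ha, ?_, ?_, fun m hm => ?_⟩
  · exact (L.arrow_mk_iso_iff (LatchingFactorization.relativeLatchingMapIso hf₁ h.i rfl hf₂)).2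
      h.hi
  · have := hp n le_rfl
    exact (R.arrow_mk_iso_iff (D.relativeMatchingMapIso p)).2 h.hp
  · have := hp m hm.le
    exact D.isIso_relativeMatchingMap_modificationProj p hm

end

end

end CanonicalModel

namespace CanonicalModel

noncomputable section

variable {C : Type u} [Category.{v} C]

/-! ### Limits of towers that are constant in each degree from some stage on -/

section

variable {Z : ℕ → SimplicialObject C} (t : ∀ n, Z (n + 1) ⟶ Z n)
  (ht : ∀ n a, degree a < n → IsIso ((t n).app a))

include ht

lemma isEventuallyConstantTo_flip_ofOpSequence (n : ℕ) (a : SimplexCategoryᵒᵖ)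
    (ha : degree a < n) :
    ((Functor.ofOpSequence t).flip.obj a).IsEventuallyConstantTo (op n) := by
  rintro ⟨i⟩ φ
  obtain ⟨k, rfl⟩ := Nat.exists_eq_add_of_le (leOfHom φ.unop)
  obtain rfl : φ = (homOfLE (Nat.le_add_right n k)).op := Subsingleton.elim _ _
  induction k with
  | zero => exact inferInstanceAs (IsIso (((Functor.ofOpSequence t).flip.obj a).map (𝟙 (op n))))
  | succ k hk =>
    have h₁ : IsIso (((Functor.ofOpSequence t).flip.obj a).map
        (homOfLE (Nat.le_add_right n k)).op) := hk
    have h₂ : IsIso (((Functor.ofOpSequence t).flip.obj a).map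
        (homOfLE (Nat.le_add_right (n + k) 1)).op) := by
      have := ht (n + k) a (by omega)
      rw [Functor.flip_obj_map, Functor.ofOpSequence_map_homOfLE_succ]
      exact this
    have : (homOfLE (Nat.le_add_right n (k + 1))).op =
        (homOfLE (Nat.le_add_right (n + k) 1)).op ≫ (homOfLE (Nat.le_add_right n k)).op :=
      Subsingleton.elim _ _
    rw [this, Functor.map_comp]
    exact IsIso.comp_isIso

/-- In degree `a` the tower is constant from stage `a + 1` on, so its limit exists in each degree
without assuming sequential limits in `C`. -/
theorem exists_limit_of_tower :
    ∃ (W : SimplicialObject C) (π : ∀ n, W ⟶ Z n), (∀ n, π (n + 1) ≫ t n = π n) ∧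
      (∀ n a, degree a < n → IsIso ((π n).app a)) ∧
      ∀ (X : SimplicialObject C) (f : ∀ n, X ⟶ Z n), (∀ n, f (n + 1) ≫ t n = f n) →
        ∃ g : X ⟶ W, ∀ n, g ≫ π n = f n := by
  let F := Functor.ofOpSequence t
  have hF (n a) (ha : degree a < n) : (F.flip.obj a).IsEventuallyConstantTo (op n) :=
    isEventuallyConstantTo_flip_ofOpSequence t ht n a ha
  have (a : SimplexCategoryᵒᵖ) : HasLimit (F.flip.obj a) :=
    (hF (degree a + 1) a (Nat.lt_succ_self _)).hasLimit
  have hsucc (n : ℕ) : limit.π F (op (n + 1)) ≫ t n = limit.π F (op n) := by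
    rw [← limit.w F (homOfLE (Nat.le_add_right n 1)).op]
    exact congr_arg (_ ≫ ·) (Functor.ofOpSequence_map_homOfLE_succ t n).symm
  refine ⟨limit F, fun n => limit.π F (op n), hsucc, fun n a ha => ?_, fun X f hf => ?_⟩
  · exact (hF n a ha).isIso_π_of_isLimit
      (isLimitOfPreserves ((evaluation _ _).obj a) (limit.isLimit F))
  · let c : Cone F := Cone.mk X (NatTrans.ofOpSequence (F := (Functor.const _).obj X) (G := F) f
      (fun n => by
        refine (Category.id_comp _).trans ((hf n).symm.trans ?_)
        exact congr_arg (_ ≫ ·) (Functor.ofOpSequence_map_homOfLE_succ t n).symm))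
    exact ⟨limit.lift F c, fun n => limit.lift_π c (op n)⟩

end

/-! ### Reedy factorizations -/

section

variable [HasFiniteLimits C] {Y : SimplicialObject C}

lemma isIso_relativeMatchingMap_id (n : ℕ) : IsIso (relativeMatchingMap n (𝟙 Y)) := by
  have : IsIso (matchingObjMap n (𝟙 Y)) := by rw [matchingObjMap_id]; infer_instance
  have : IsIso (relativeMatchingMap n (𝟙 Y) ≫ pullback.fst _ _) := by
    rw [relativeMatchingMap_fst]
    infer_instance
  exact IsIso.of_isIso_comp_right _ (pullback.fst _ _)

end

section

variable [HasFiniteColimits C] [HasFiniteLimits C] {X Y : SimplicialObject C}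

/-- The stages in the construction of Reedy factorizations. -/
structure FactorizationStage (g : X ⟶ Y) (n : ℕ) where
  /-- the intermediate object -/
  obj : SimplicialObject C
  /-- the first map of the factorization -/
  i : X ⟶ obj
  /-- the second map of the factorization -/
  p : obj ⟶ Y
  fac : i ≫ p = g
  isIso (m : ℕ) (hm : n ≤ m) : IsIso (relativeMatchingMap m p)

/-- Any pair of classes of morphisms that has factorizations in `C` gives rise to
factorizations in the category of simplicial objects. -/
theorem exists_reedy_factorization (L R : MorphismProperty C) [L.RespectsIso] [R.RespectsIso]
    [L.HasFactorization R] (g : X ⟶ Y) :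
    ∃ (Z : SimplicialObject C) (i : X ⟶ Z) (p : Z ⟶ Y), i ≫ p = g ∧
      (∀ n, L (relativeLatchingMap n i)) ∧ ∀ n, R (relativeMatchingMap n p) := by
  have step (n : ℕ) (S : FactorizationStage g n) : ∃ (S' : FactorizationStage g (n + 1))
      (t : S'.obj ⟶ S.obj), S'.i ≫ t = S.i ∧ t ≫ S.p = S'.p ∧
      (∀ a, degree a < n → IsIso (t.app a)) ∧ L (relativeLatchingMap n S'.i) ∧
      R (relativeMatchingMap n S'.p) := by
    obtain ⟨Z', f', t, fac, ht, h₁, h₂, h₃⟩ := exists_factorization_step L R n S.i S.p S.isIso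
    exact ⟨⟨Z', f', t ≫ S.p, by rw [← Category.assoc, fac, S.fac], h₃⟩, t, fac, rfl, ht, h₁, h₂⟩
  choose next t ht₁ ht₂ ht₃ ht₄ ht₅ using step
  -- The tower starts from `Y` itself, since all relative matching maps of its identity are
  -- invertible.
  let S (n : ℕ) : FactorizationStage g n := Nat.rec
    ⟨Y, g, 𝟙 Y, Category.comp_id _, fun _ _ => isIso_relativeMatchingMap_id _⟩ next n
  obtain ⟨W, π, hπ₁, hπ₂, hπ₃⟩ := exists_limit_of_tower (Z := fun n => (S n).obj)
    (fun n => t n (S n)) (fun n => ht₃ n (S n))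
  obtain ⟨i, hi⟩ := hπ₃ X (fun n => (S n).i) (fun n => ht₁ n (S n))
  have hp (n : ℕ) : π n ≫ (S n).p = π 0 ≫ (S 0).p := by
    induction n with
    | zero => rfl
    | succ n hn =>
      rw [← hn, ← hπ₁ n, Category.assoc]
      exact congr_arg (_ ≫ ·) (ht₂ n (S n)).symm
  refine ⟨W, i, π 0 ≫ (S 0).p, ?_, fun n => ?_, fun n => ?_⟩
  · rw [← Category.assoc, hi, (S 0).fac]
  -- Degree `n` is compared with stage `n + 1`, whose projection from `W` is invertible in all
  -- degrees `≤ n`.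
  · exact (L.arrow_mk_iso_iff (relativeLatchingMapIso n (hi (n + 1))
      (fun a ha => hπ₂ _ a (Nat.lt_succ_of_le ha)))).2 (ht₄ n (S n))
  · rw [← hp (n + 1)]
    exact (R.arrow_mk_iso_iff (relativeMatchingMapIso n (π (n + 1)) (S (n + 1)).p
      (fun a ha => hπ₂ _ a (Nat.lt_succ_of_le ha)))).2 (ht₅ n (S n))

end

end

end CanonicalModel

/-! ### Weak equivalences and fibrations of the canonical model structure. -/

namespace CanonicalModel

noncomputable section

variable {C : Type u} [Category.{v} C] [ModelCategory C]

/-! ### Level properties of maps with good relative latching or matching maps -/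

section

variable {X Y : SimplicialObject C}

/-- The map `pₙ` is the relative matching map followed by a base change of `Mₙ p`, and `Mₙ p` lifts
against all cofibrations. -/
lemma trivialFibrations_app {p : X ⟶ Y} (hp : ∀ n, trivialFibrations C (relativeMatchingMap n p))
    (n : ℕ) : trivialFibrations C (p.app (op ⦋n⦌)) := by
  have h₁ : trivialFibrations C (matchingObjMap n p) := by
    rw [← cofibrations_rlp]
    intro A B i hi
    refine hasLiftingProperty_matchingObjMap p n i fun m _ => ?_
    have := hp m
    rw [← cofibrations_rlp] at this
    exact this _ hi
  rw [← relativeMatchingMap_fst]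
  exact (trivialFibrations C).comp_mem _ _ (hp n) ((trivialFibrations C).of_isPullback
    (IsPullback.of_hasPullback (matchingMap n Y) (matchingObjMap n p)).flip h₁)

lemma trivialCofibrations_latchingObjMap {i : X ⟶ Y} {n : ℕ}
    (hi : ∀ m < n, trivialCofibrations C (relativeLatchingMap m i)) :
    trivialCofibrations C (latchingObjMap n i) := by
  rw [← fibrations_llp]
  intro A B p hp
  refine hasLiftingProperty_latchingObjMap i n p fun m hm => ?_
  have := hi m hm
  rw [← fibrations_llp] at this
  exact this _ hp

lemma trivialCofibrations_inl {i : X ⟶ Y} {n : ℕ}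
    (hi : ∀ m < n, trivialCofibrations C (relativeLatchingMap m i)) :
    trivialCofibrations C (pushout.inl (latchingMap n X) (latchingObjMap n i)) :=
  (trivialCofibrations C).of_isPushout
    (IsPushout.of_hasPushout (latchingMap n X) (latchingObjMap n i))
    (trivialCofibrations_latchingObjMap hi)

lemma levelEquivalences_of_trivialCofibrations {i : X ⟶ Y}
    (hi : ∀ n, trivialCofibrations C (relativeLatchingMap n i)) : levelEquivalences C i := by
  intro n
  rw [← inl_relativeLatchingMap, weakEquivalence_iff]
  exact ((trivialCofibrations C).comp_mem _ _ (trivialCofibrations_inl fun m _ => hi m)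
    (hi n)).2

/-- By induction on the degree, `Xₙ ⟶ Xₙ ∐_{Lₙ X} Lₙ Y` is a trivial cofibration; two out of three
for its composite with the relative latching map concludes. -/
lemma trivialCofibrations_relativeLatchingMap {i : X ⟶ Y} (hi : reedyCofibrations C i)
    (hi' : levelEquivalences C i) (n : ℕ) : trivialCofibrations C (relativeLatchingMap n i) := by
  induction n using Nat.strong_induction_on with
  | _ n hn =>
    have : WeakEquivalence (pushout.inl (latchingMap n X) (latchingObjMap n i)) :=
      (weakEquivalence_iff _).2 (trivialCofibrations_inl hn).2
    have := hi' n
    rw [mem_trivialCofibrations_iff]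
    exact ⟨hi n, weakEquivalence_of_precomp_of_fac (inl_relativeLatchingMap i)⟩

lemma hasLiftingProperty_of_trivialCofibrations {Z W : SimplicialObject C} {i : X ⟶ Y} {p : Z ⟶ W}
    (hi : ∀ n, trivialCofibrations C (relativeLatchingMap n i)) (hp : reedyFibrations C p) :
    HasLiftingProperty i p :=
  hasLiftingProperty_of_relativeLatchingMap_of_relativeMatchingMap i p fun n => by
    have := hp n
    have h := hi n
    rw [← fibrations_llp] at h
    exact h _ (mem_fibrations _)

lemma reedyFibrations_of_retract {X' Y' : SimplicialObject C} {f : X ⟶ Y} {g : X' ⟶ Y'}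
    (h : RetractArrow f g) (hg : reedyFibrations C g) : reedyFibrations C f := fun n => by
  have h' : RetractArrow (relativeMatchingMap n f) (relativeMatchingMap n g) :=
    Retract.map h (relativeMatchingFunctor n)
  rw [fibration_iff]
  exact (fibrations C).of_retract h' (hg n).mem

lemma trivialFibrations_app_of_retract {X' Y' : SimplicialObject C} {f : X ⟶ Y} {g : X' ⟶ Y'}
    (h : RetractArrow f g) (n : ℕ) (hg : trivialFibrations C (g.app (op ⦋n⦌))) :
    trivialFibrations C (f.app (op ⦋n⦌)) :=
  (trivialFibrations C).of_retract (h.map ((evaluation _ _).obj (op ⦋n⦌))) hg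

/-- Lifting against the first factor of a Reedy factorization exhibits `f` as a retract of the
second. -/
lemma trivialFibrations_app_of_hasLiftingProperty {f : X ⟶ Y}
    (hf : ∀ ⦃A B : SimplicialObject C⦄ (i : A ⟶ B), reedyCofibrations C i →
      HasLiftingProperty i f) (n : ℕ) : trivialFibrations C (f.app (op ⦋n⦌)) := by
  obtain ⟨Z, i, p, fac, hi, hp⟩ :=
    exists_reedy_factorization (cofibrations C) (trivialFibrations C) f
  have := hf i fun n => (cofibration_iff _).2 (hi n)
  exact trivialFibrations_app_of_retract (RetractArrow.ofRightLiftingProperty fac) n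
    (trivialFibrations_app hp n)

end

/-! ### Homotopically constant objects -/

section

variable {X Y : SimplicialObject C}

lemma IsHomotopicallyConstant.of_levelEquivalences {f : X ⟶ Y} (hf : levelEquivalences C f)
    (hX : IsHomotopicallyConstant X) : IsHomotopicallyConstant Y where
  δ n i := by
    have := hX.δ n i
    have := hf n
    have := hf (n + 1)
    have h : f.app (op ⦋n + 1⦌) ≫ Y.δ i = X.δ i ≫ f.app (op ⦋n⦌) :=
      (f.naturality _).symm
    have : WeakEquivalence (f.app (op ⦋n + 1⦌) ≫ Y.δ i) := by rw [h]; infer_instance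
    exact weakEquivalence_of_precomp (f.app (op ⦋n + 1⦌)) _
  σ n i := by
    have := hX.σ n i
    have := hf n
    have := hf (n + 1)
    have h : f.app (op ⦋n⦌) ≫ Y.σ i = X.σ i ≫ f.app (op ⦋n + 1⦌) :=
      (f.naturality _).symm
    have : WeakEquivalence (f.app (op ⦋n⦌) ≫ Y.σ i) := by rw [h]; infer_instance
    exact weakEquivalence_of_precomp (f.app (op ⦋n⦌)) _

lemma isHomotopicallyConstant_const (A : C) :
    IsHomotopicallyConstant ((SimplicialObject.const C).obj A) where
  δ _ _ := inferInstanceAs (WeakEquivalence (𝟙 A))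
  σ _ _ := inferInstanceAs (WeakEquivalence (𝟙 A))

lemma IsHomotopicallyConstant.weakEquivalence_map (hX : IsHomotopicallyConstant X) (n : ℕ)
    (g : ⦋n⦌ ⟶ ⦋0⦌) : WeakEquivalence (X.map g.op) := by
  induction n with
  | zero =>
    obtain rfl : g = 𝟙 _ := Subsingleton.elim _ _
    rw [op_id, X.map_id]
    infer_instance
  | succ n hn =>
    obtain rfl : g = SimplexCategory.σ 0 ≫ SimplexCategory.isTerminalZero.from _ :=
      SimplexCategory.isTerminalZero.hom_ext _ _
    have := hn (SimplexCategory.isTerminalZero.from _)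
    have : WeakEquivalence (X.map (SimplexCategory.σ (0 : Fin (n + 1))).op) := hX.σ n 0
    rw [op_comp, X.map_comp]
    infer_instance

lemma IsHomotopicallyConstant.levelEquivalences_counit (hX : IsHomotopicallyConstant X) :
    levelEquivalences C ((constEvAdj C).counit.app X) :=
  fun n => hX.weakEquivalence_map n (SimplexCategory.isTerminalZero.from _)

end

/-! ### Canonical model structures -/

namespace IsCanonicalModelStructure

variable [ModelCategory (SimplicialObject C)] (hcan : IsCanonicalModelStructure C)
  {X Y : SimplicialObject C}

include hcan

lemma trivialCofibrations_of_relativeLatchingMap {i : X ⟶ Y}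
    (hi : ∀ n, trivialCofibrations C (relativeLatchingMap n i)) :
    trivialCofibrations (SimplicialObject C) i := by
  refine ⟨?_, hcan.levelEquivalences_le _ (levelEquivalences_of_trivialCofibrations hi)⟩
  rw [hcan.cofibrations_eq]
  exact fun n => (cofibration_iff _).2 (hi n).1

lemma trivialFibrations_app {f : X ⟶ Y} (hf : trivialFibrations (SimplicialObject C) f) (n : ℕ) :
    trivialFibrations C (f.app (op ⦋n⦌)) := by
  rw [← cofibrations_rlp, hcan.cofibrations_eq] at hf
  exact trivialFibrations_app_of_hasLiftingProperty (fun A B i hi => hf i hi) n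

/-- Ken Brown's argument: `f` factors as a section of a trivial fibration followed by a fibration,
and the latter is trivial when `f` is a weak equivalence. Trivial fibrations are already known to be
level equivalences. -/
lemma weakEquivalence_iff (f : X ⟶ Y) (hX : IsFibrant X) (hY : IsFibrant Y) :
    WeakEquivalence f ↔ levelEquivalences C f := by
  refine ⟨fun _ n => ?_, fun hf =>
    (HomotopicalAlgebra.weakEquivalence_iff _).2 (hcan.levelEquivalences_le _ hf)⟩
  obtain ⟨h⟩ : Nonempty (FibrantBrownFactorization f) := inferInstance
  have hp : WeakEquivalence (h.p.app (op ⦋n⦌)) := (HomotopicalAlgebra.weakEquivalence_iff _).2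
    (hcan.trivialFibrations_app ((mem_trivialFibrations_iff _).2 ⟨⟨h.hp⟩, inferInstance⟩) n).2
  have hr : WeakEquivalence (h.r.app (op ⦋n⦌)) := (HomotopicalAlgebra.weakEquivalence_iff _).2
    (hcan.trivialFibrations_app ((mem_trivialFibrations_iff _).2
      ⟨inferInstance, inferInstance⟩) n).2
  have hi : WeakEquivalence (h.i.app (op ⦋n⦌)) :=
    weakEquivalence_of_postcomp_of_fac (fg := 𝟙 _) (congr_app h.i_r (op ⦋n⦌))
  rw [← h.fac, NatTrans.comp_app]
  infer_instance

/-- The Reedy factorization of `f` starts with a canonical trivial cofibration, so `f` is a retract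
of its second factor, a Reedy fibration. -/
lemma reedyFibrations_of_fibration (f : X ⟶ Y) [Fibration f] : reedyFibrations C f := by
  obtain ⟨Z, i, p, fac, hi, hp⟩ :=
    exists_reedy_factorization (trivialCofibrations C) (fibrations C) f
  obtain ⟨_, _⟩ := (mem_trivialCofibrations_iff _).1
    (hcan.trivialCofibrations_of_relativeLatchingMap hi)
  exact reedyFibrations_of_retract (RetractArrow.ofRightLiftingProperty fac)
    fun n => (fibration_iff _).2 (hp n)

lemma fibration_iff (f : X ⟶ Y) (hX : IsFibrant X) (hY : IsFibrant Y) :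
    Fibration f ↔ reedyFibrations C f := by
  refine ⟨fun _ => hcan.reedyFibrations_of_fibration f, fun hf => ?_⟩
  let h := MorphismProperty.factorizationData (trivialCofibrations (SimplicialObject C))
    (fibrations (SimplicialObject C)) f
  have hp : Fibration h.p := ⟨h.hp⟩
  obtain ⟨hi₁, hi₂⟩ := (mem_trivialCofibrations_iff _).1 h.hi
  -- Fibrancy of the middle object makes `h.i` a level equivalence, so that the Reedy fibration `f`
  -- lifts against it and is a retract of `h.p`.
  have hZ : IsFibrant h.Z := isFibrant_of_fibration h.p
  have hi₃ : reedyCofibrations C h.i := by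
    rw [← hcan.cofibrations_eq]
    exact hi₁.mem
  have := hasLiftingProperty_of_trivialCofibrations (trivialCofibrations_relativeLatchingMap hi₃
    ((hcan.weakEquivalence_iff h.i hX hZ).1 hi₂)) hf
  rw [HomotopicalAlgebra.fibration_iff]
  exact MorphismProperty.of_retract (RetractArrow.ofRightLiftingProperty h.fac) h.hp

lemma isQuillenAdjunction : IsQuillenAdjunction (constEvAdj C) := by
  have hcof : cofibrations C ≤
      (cofibrations (SimplicialObject C)).inverseImage (SimplicialObject.const C) := by
    intro A B i hi
    -- By adjunction it is enough that `Ev` preserves trivial fibrations, which is their level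
    -- property in degree zero.
    rw [MorphismProperty.inverseImage_iff, ← trivialFibrations_llp]
    intro X Y p hp
    refine ((constEvAdj C).hasLiftingProperty_iff i p).2 ?_
    have := hcan.trivialFibrations_app hp 0
    rw [← cofibrations_rlp] at this
    exact this i hi
  refine ⟨hcof, fun A B i hi => ⟨hcof _ hi.1, hcan.levelEquivalences_le _ ?_⟩⟩
  have : WeakEquivalence i := ⟨hi.2⟩
  exact fun _ => inferInstanceAs (WeakEquivalence i)

/-- Any constant object has a fibrant replacement by a level equivalence. -/
lemma exists_levelEquivalence_const (A : C) :
    ∃ (Z : SimplicialObject C) (w : (SimplicialObject.const C).obj A ⟶ Z), IsFibrant Z ∧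
      levelEquivalences C w := by
  obtain ⟨Z, i, p, fac, hi, hp⟩ := exists_reedy_factorization (trivialCofibrations C)
    (fibrations C) (terminal.from ((SimplicialObject.const C).obj A))
  have hi' := levelEquivalences_of_trivialCofibrations hi
  refine ⟨Z, i, (hcan.isFibrant_iff Z).2
    ⟨(isHomotopicallyConstant_const A).of_levelEquivalences hi', ?_⟩, hi'⟩
  obtain rfl : p = terminal.from Z := Subsingleton.elim _ _
  exact fun n => (HomotopicalAlgebra.fibration_iff _).2 (hp n)

end IsCanonicalModelStructure

end

end CanonicalModel

/-! ### Derived functors and the Quillen equivalence. -/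

namespace CanonicalModel

noncomputable section

/-! ### A criterion for Quillen equivalences -/

section

variable {C : Type u} [Category.{v} C] {D : Type u'} [Category.{v'} D]
  [ModelCategory C] [ModelCategory D] {F : C ⥤ D} {G : D ⥤ C}

/-- A Quillen adjunction such that the left adjoint preserves weak equivalences is a Quillen
equivalence if the counit is a weak equivalence at fibrant objects, and the derived unit is a weak
equivalence. -/
theorem IsQuillenAdjunction.isQuillenEquivalence {adj : F ⊣ G} (h : IsQuillenAdjunction adj)
    (hF : ∀ ⦃A B : C⦄ (f : A ⟶ B), WeakEquivalence f → WeakEquivalence (F.map f))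
    (hG : ∀ ⦃X Y : D⦄ (f : X ⟶ Y), IsFibrant X → IsFibrant Y → WeakEquivalence f →
      WeakEquivalence (G.map f))
    (hcounit : ∀ X : D, IsFibrant X → WeakEquivalence (adj.counit.app X))
    (hunit : ∀ A : C, ∃ (Z : D) (w : F.obj A ⟶ Z), IsFibrant Z ∧ WeakEquivalence w ∧
      WeakEquivalence (adj.unit.app A ≫ G.map w)) :
    IsQuillenEquivalence adj where
  toIsQuillenAdjunction := h
  exists_derived_equivalence := by
    let W₁ := weakEquivalences C
    let W₂ := weakEquivalences D
    let Φ := FibrantObject.localizerMorphism D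
    have isIso₁ {A B : C} (f : A ⟶ B) (hf : WeakEquivalence f) : IsIso (W₁.Q.map f) :=
      Localization.inverts W₁.Q W₁ f hf.mem
    have isIso₂ {X Y : D} (f : X ⟶ Y) (hf : WeakEquivalence f) : IsIso (W₂.Q.map f) :=
      Localization.inverts W₂.Q W₂ f hf.mem
    have invF : W₁.IsInvertedBy (F ⋙ W₂.Q) := fun A B f hf => isIso₂ _ (hF f ⟨hf⟩)
    have derG : Φ.Derives (G ⋙ W₁.Q) := fun X Y f hf =>
      isIso₁ _ (hG f.hom X.property Y.property ⟨hf⟩)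
    let F' : W₁.Localization ⥤ W₂.Localization := Localization.lift (F ⋙ W₂.Q) invF W₁.Q
    let α : W₁.Q ⋙ F' ⟶ F ⋙ W₂.Q := (Localization.fac (F ⋙ W₂.Q) invF W₁.Q).hom
    have := derG.hasPointwiseRightDerivedFunctor
    let G' : W₂.Localization ⥤ W₁.Localization := (G ⋙ W₁.Q).totalRightDerived W₂.Q W₂
    let β : G ⋙ W₁.Q ⟶ W₂.Q ⋙ G' := (G ⋙ W₁.Q).totalRightDerivedUnit W₂.Q W₂
    have hα : F'.IsLeftDerivedFunctor α W₁ :=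
      (Functor.isLeftDerivedFunctor_iff_of_inverts _ _ invF).2 inferInstance
    have hβ : G'.IsRightDerivedFunctor β W₂ := inferInstance
    have isIsoβ (X : D) (hX : IsFibrant X) : IsIso (β.app X) :=
      derG.isIso_of_isRightDerivedFunctor β (FibrantObject.mk X)
    -- The derived adjunction requires that both composites are again derived functors.
    have hα' : (F' ⋙ G').IsLeftDerivedFunctor
        ((Functor.associator _ _ _).inv ≫ Functor.whiskerRight α G') W₁ :=
      (Functor.isLeftDerivedFunctor_iff_of_inverts _ _ fun A B f hf => by
        have := invF f hf
        exact inferInstanceAs (IsIso (G'.map ((F ⋙ W₂.Q).map f)))).2 inferInstance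
    have hβ' : (G' ⋙ F').IsRightDerivedFunctor
        (Functor.whiskerRight β F' ≫ (Functor.associator _ _ _).hom) W₂ := by
      have derGF : Φ.Derives ((G ⋙ W₁.Q) ⋙ F') := fun X Y f hf => by
        have := derG f hf
        exact inferInstanceAs (IsIso (F'.map ((Φ.functor ⋙ G ⋙ W₁.Q).map f)))
      refine derGF.isRightDerivedFunctor_of_isIso _ fun X => ?_
      have : IsIso (β.app (Φ.functor.obj X)) := isIsoβ _ X.property
      have : IsIso (F'.map (β.app (Φ.functor.obj X))) := Functor.map_isIso F' _
      simpa using this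
    let adj' : F' ⊣ G' := adj.derived W₁ W₂ α β
    have counit_fac (X : D) : F'.map (β.app X) ≫ adj'.counit.app (W₂.Q.obj X) =
        α.app (G.obj X) ≫ W₂.Q.map (adj.counit.app X) := adj.derivedε_fac_app W₂ α β X
    have unit_fac (A : C) : adj'.unit.app (W₁.Q.obj A) ≫ G'.map (α.app A) =
        W₁.Q.map (adj.unit.app A) ≫ β.app (F.obj A) := adj.derivedη_fac_app W₁ α β A
    have isIso_counit (Y : W₂.Localization) : IsIso (adj'.counit.app Y) := by
      -- Every object of `Ho D` comes from a fibrant object, where `β` is invertible and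
      -- `counit_fac` compares the derived counit with the original one.
      have := Φ.essSurj_of_hasRightResolutions W₂.Q
      rw [NatTrans.isIso_app_iff_of_iso adj'.counit ((Φ.functor ⋙ W₂.Q).objObjPreimageIso Y).symm]
      generalize (Φ.functor ⋙ W₂.Q).objPreimage Y = X
      have : IsIso (β.app X.obj) := isIsoβ _ X.property
      have hα : IsIso (α.app (G.obj X.obj)) := inferInstance
      exact @IsIso.of_isIso_fac_left _ _ _ _ _ _ _ _ (Functor.map_isIso F' (β.app X.obj))
        (IsIso.comp_isIso' hα (isIso₂ _ (hcounit _ X.property))) (counit_fac X.obj)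
    have isIso_unit (B : W₁.Localization) : IsIso (adj'.unit.app B) := by
      have := Localization.essSurj W₁.Q W₁
      rw [NatTrans.isIso_app_iff_of_iso adj'.unit (W₁.Q.objObjPreimageIso B).symm]
      generalize W₁.Q.objPreimage B = A
      obtain ⟨Z, w, hZ, hw, hw'⟩ := hunit A
      have := isIsoβ Z hZ
      have := isIso₂ w hw
      have := isIso₁ _ hw'
      have nat : W₁.Q.map (G.map w) ≫ β.app Z = β.app (F.obj A) ≫ G'.map (W₂.Q.map w) :=
        β.naturality w
      -- Since `β` need not be invertible at `F.obj A`, the unit is transported along `w` to the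
      -- fibrant object `Z`.
      have fac : adj'.unit.app (W₁.Q.obj A) ≫ G'.map (α.app A) ≫ G'.map (W₂.Q.map w) =
          W₁.Q.map (adj.unit.app A ≫ G.map w) ≫ β.app Z := by
        rw [← Category.assoc, unit_fac, Functor.map_comp, Category.assoc, Category.assoc, nat]
      have : IsIso (adj'.unit.app (W₁.Q.obj A) ≫ G'.map (α.app A) ≫ G'.map (W₂.Q.map w)) := by
        rw [fac]
        infer_instance
      exact IsIso.of_isIso_comp_right _ (G'.map (α.app A) ≫ G'.map (W₂.Q.map w))
    exact ⟨adj'.toEquivalence, α, β, hα, hβ, unit_fac, counit_fac⟩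

end

end

end CanonicalModel

theorem proposition3p8 {C : Type u} [Category.{v} C] [ModelCategory C]
    [ModelCategory (SimplicialObject C)] (hcan : CanonicalModel.IsCanonicalModelStructure C) :
    CanonicalModel.IsQuillenEquivalence (CanonicalModel.constEvAdj C) ∧
    (∀ ⦃X Y : SimplicialObject C⦄ (f : X ⟶ Y), IsFibrant X → IsFibrant Y →
      (WeakEquivalence f ↔ CanonicalModel.levelEquivalences C f)) ∧
    (∀ ⦃X Y : SimplicialObject C⦄ (f : X ⟶ Y), IsFibrant X → IsFibrant Y →
      (Fibration f ↔ CanonicalModel.reedyFibrations C f)) := by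
  have weq {X Y : SimplicialObject C} {f : X ⟶ Y} (hf : CanonicalModel.levelEquivalences C f) :
      WeakEquivalence f := ⟨hcan.levelEquivalences_le _ hf⟩
  refine ⟨hcan.isQuillenAdjunction.isQuillenEquivalence
    (fun A B f hf => weq fun _ => hf)
    (fun X Y f hX hY hf => (hcan.weakEquivalence_iff f hX hY).1 hf 0)
    (fun X hX => weq ((hcan.isFibrant_iff X).1 hX).1.levelEquivalences_counit)
    (fun A => ?_), fun X Y f hX hY => hcan.weakEquivalence_iff f hX hY,
    fun X Y f hX hY => hcan.fibration_iff f hX hY⟩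
  obtain ⟨Z, w, hZ, hw⟩ := hcan.exists_levelEquivalence_const A
  have := hw 0
  -- `Ev (cA)` is `A` and the unit is the identity, so the derived unit is the weak equivalence
  -- `w₀`.
  have : IsIso ((CanonicalModel.constEvAdj C).unit.app A) := inferInstanceAs (IsIso (𝟙 A))
  have : WeakEquivalence ((CanonicalModel.ev C).map w) := hw 0
  exact ⟨Z, w, hZ, weq hw, inferInstance⟩
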